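/- Let $\mathfrak g$ be a Lie algebra over $\mathbb C$ (of arbitrary dimension), $\mathfrak p$ an ideal of $\mathfrak g$, and $\phi:\mathfrak p\to\mathbb C$ a Lie algebra homomorphism. Put $$\mathfrak g^{\phi}=\{g\in\mathfrak g\mid \phi([g,p])=0\ \text{ for all } p\in\mathfrak p\},$$ a subalgebra of $\mathfrak g$ containing $\mathfrak p$. Let $\mathbb C w_\phi$ be the one-dimensional $\mathfrak p$-module on which $p\in\mathfrak p$ acts as the scalar $\phi(p)$, let $W(\phi)=\mathrm{Ind}_{\mathfrak p}^{\mathfrak g}\,\mathbb C w_\phi=U(\mathfrak g)\otimes_{U(\mathfrak p)}\mathbb C w_\phi$, and write $w_\phi$ for $1\otimes w_\phi$. For a Lie algebra homomorphism $\phi':\mathfrak g^\phi\to\mathbb C$ let $V(\phi')=\mathrm{Ind}_{\mathfrak g^\phi}^{\mathfrak g}\,\mathbb C v_{\phi'}$, where $\mathbb C v_{\phi'}$ is the one-dimensional $\mathfrak g^\phi$-module on which $g\in\mathfrak g^\phi$ acts as the scalar $\phi'(g)$. Assume that $\dim \mathfrak g^\phi/\mathfrak p\le 1$. 1. If $\dim\mathfrak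 g^\phi/\mathfrak p=0$, then $W(\phi)$ is an irreducible $\mathfrak g$-module. 2. Suppose $\dim\mathfrak g^\phi/\mathfrak p=1$. Let $y\in\mathfrak g^\phi$ be such that $\mathfrak g^\phi=\mathbb C y\oplus\mathfrak p$, and let $(x_i)_{i\in I}$, with $I$ a totally ordered (possibly empty) set, be a basis of a vector space complement of $\mathfrak g^\phi$ in $\mathfrak g$. For a finitely supported $\alpha:I\to\mathbb Z_{\ge 0}$ with support $i_1<\dots<i_n$ put $x^\alpha=x_{i_1}^{\alpha_{i_1}}\cdots x_{i_n}^{\alpha_{i_n}}\in U(\mathfrak g)$ (and $x^0=1$), and for $\xi\in\mathbb C$ let $$J_\xi=\mathrm{span}_{\mathbb C}\{x^\alpha y^n(y-\xi)w_\phi\mid \alpha:I\to\mathbb Z_{\ge0}\text{ finitely supported},\ n\in\mathbb Z_{\ge0}\}\subseteq W(\phi).$$ Then every $J_\xi$ is a $\mathfrak g$-submodule of $W(\phi)$, and the maximal submodules of $W(\phi)$ are exactly the $J_\xi$, $\xi\in\mathbb C$. Moreover, for every Lie algebra homomorphism $\phi':\mathfrak g^\phi\to\mathbb C$ extending $\phi$,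 there is an isomorphism of $\mathfrak g$-modules $V(\phi')\cong W(\phi)/J_{\phi'(y)}$. -/

import Mathlib

open scoped TensorProduct

namespace QuasiWhittaker

attribute [local instance 100] LieRing.ofAssociativeRing

noncomputable section

section Induced

variable {R : Type*} {H L M : Type*} [CommRing R]
  [LieRing H] [LieAlgebra R H] [LieRing L] [LieAlgebra R L]

/-- The relations `(u f(a)) ⊗ m = u ⊗ (a m)`, for `u ∈ U(L)`, `a ∈ U(H)` and `m ∈ M`, that turn
`U(L) ⊗_R M` into `U(L) ⊗_{U(H)} M`; here `U(L)` is a right `U(H)`-module through the algebra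
homomorphism `U(H) → U(L)` extending the Lie algebra homomorphism `f : H → L`. -/
def indRelations (f : H →ₗ⁅R⁆ L) (M : Type*) [AddCommGroup M] [Module R M] [LieRingModule H M]
    [LieModule R H M] :
    Submodule (UniversalEnvelopingAlgebra R L) (UniversalEnvelopingAlgebra R L ⊗[R] M) :=
  Submodule.span _
    {t | ∃ (u : UniversalEnvelopingAlgebra R L) (a : UniversalEnvelopingAlgebra R H) (m : M),
      t = (u * UniversalEnvelopingAlgebra.lift R
              ((UniversalEnvelopingAlgebra.ι R).comp f) a) ⊗ₜ[R] m
          - u ⊗ₜ[R] (UniversalEnvelopingAlgebra.lift R (LieModule.toEnd R H M) a m)}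

/-- The induced module `Ind_H^L M = U(L) ⊗_{U(H)} M` along a Lie algebra homomorphism
`f : H → L` (below, the inclusion of an ideal or of a subalgebra). -/
def Ind (f : H →ₗ⁅R⁆ L) (M : Type*) [AddCommGroup M] [Module R M] [LieRingModule H M]
    [LieModule R H M] :=
  (UniversalEnvelopingAlgebra R L ⊗[R] M) ⧸ indRelations f M

variable (f : H →ₗ⁅R⁆ L) [AddCommGroup M] [Module R M] [LieRingModule H M] [LieModule R H M]

instance : AddCommGroup (Ind f M) :=
  inferInstanceAs (AddCommGroup ((UniversalEnvelopingAlgebra R L ⊗[R] M) ⧸ indRelations f M))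

instance : Module (UniversalEnvelopingAlgebra R L) (Ind f M) :=
  inferInstanceAs (Module (UniversalEnvelopingAlgebra R L)
    ((UniversalEnvelopingAlgebra R L ⊗[R] M) ⧸ indRelations f M))

instance : Module R (Ind f M) :=
  inferInstanceAs (Module R ((UniversalEnvelopingAlgebra R L ⊗[R] M) ⧸ indRelations f M))

instance : IsScalarTower R (UniversalEnvelopingAlgebra R L) (Ind f M) :=
  inferInstanceAs (IsScalarTower R (UniversalEnvelopingAlgebra R L)
    ((UniversalEnvelopingAlgebra R L ⊗[R] M) ⧸ indRelations f M))

/-- The action of the Lie algebra `L` on the induced module: `x` acts as its image in `U(L)`. -/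
instance : LieRingModule L (Ind f M) where
  bracket x v := UniversalEnvelopingAlgebra.ι R x • v
  add_lie x y v := by
    change UniversalEnvelopingAlgebra.ι R (x + y) • v = _
    rw [map_add, add_smul]
  lie_add x v w := smul_add _ v w
  leibniz_lie x y v := by
    change UniversalEnvelopingAlgebra.ι R x • UniversalEnvelopingAlgebra.ι R y • v =
      UniversalEnvelopingAlgebra.ι R ⁅x, y⁆ • v +
        UniversalEnvelopingAlgebra.ι R y • UniversalEnvelopingAlgebra.ι R x • v
    rw [LieHom.map_lie, LieRing.of_associative_ring_bracket, sub_smul, mul_smul, mul_smul,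
      sub_add_cancel]

instance : LieModule R L (Ind f M) where
  smul_lie t x v := by
    change UniversalEnvelopingAlgebra.ι R (t • x) • v = t • UniversalEnvelopingAlgebra.ι R x • v
    rw [map_smul, smul_assoc]
  lie_smul t x v := by
    change UniversalEnvelopingAlgebra.ι R x • t • v = t • UniversalEnvelopingAlgebra.ι R x • v
    rw [← algebraMap_smul (UniversalEnvelopingAlgebra R L) t v,
      ← algebraMap_smul (UniversalEnvelopingAlgebra R L) t
        (UniversalEnvelopingAlgebra.ι R x • v), ← mul_smul, ← mul_smul, Algebra.commutes]

/-- The vector `1 ⊗ m` of the induced module. -/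
def Ind.of (m : M) : Ind f M := Submodule.Quotient.mk (1 ⊗ₜ[R] m)

end Induced

section Character

variable {R : Type*} {H : Type*} [CommRing R] [LieRing H] [LieAlgebra R H]

/-- The rank one `H`-module `R v_χ` on which `x` acts as the scalar `χ(x)`. -/
def CharModule (_χ : LieAlgebra.LieCharacter R H) : Type _ := R

variable (χ : LieAlgebra.LieCharacter R H)

instance : AddCommGroup (CharModule χ) := inferInstanceAs (AddCommGroup R)

instance : Module R (CharModule χ) := inferInstanceAs (Module R R)

instance : LieRingModule H (CharModule χ) where
  bracket x v := χ x • v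
  add_lie x y v := by
    rw [map_add, add_smul]
  lie_add x v w := smul_add _ v w
  leibniz_lie x y v := by
    change χ x • χ y • v = χ ⁅x, y⁆ • v + χ y • χ x • v
    rw [LieAlgebra.lieCharacter_apply_lie, zero_smul, zero_add, smul_comm]

instance : LieModule R H (CharModule χ) where
  smul_lie t x v := by
    change χ (t • x) • v = t • χ x • v
    rw [map_smul, smul_assoc]
  lie_smul t x v := smul_comm (χ x) t v

/-- The basis vector of `CharModule χ`. -/
def CharModule.gen : CharModule χ := (1 : R)

end Character

section Whittaker

variable {L : Type*} [LieRing L] [LieAlgebra ℂ L] {p : LieIdeal ℂ L}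

/-- The Whittaker annihilator `{g ∈ L | φ([g, q]) = 0 for all q ∈ p}`, as a subalgebra of `L`.
Here `⁅g, q⁆` is the bracket of `L`, regarded as an element of the ideal `p`. -/
def whittakerAnnihilator (φ : LieAlgebra.LieCharacter ℂ p) : LieSubalgebra ℂ L where
  carrier := {g | ∀ q : p, φ ⁅g, q⁆ = 0}
  add_mem' {a b} ha hb q := by rw [add_lie, map_add, ha q, hb q, add_zero]
  zero_mem' q := by rw [zero_lie, map_zero]
  smul_mem' c a ha q := by rw [smul_lie, map_smul, ha q, smul_zero]
  lie_mem' {a b} ha hb q := by rw [lie_lie, map_sub, ha ⁅b, q⁆, hb ⁅a, q⁆, sub_zero]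

theorem mem_whittakerAnnihilator_of_mem (φ : LieAlgebra.LieCharacter ℂ p) {a : L} (ha : a ∈ p) :
    a ∈ whittakerAnnihilator φ := fun q =>
  LieAlgebra.lieCharacter_apply_lie φ ⟨a, ha⟩ q

/-- The quotient vector space `L^φ / p`. -/
abbrev AnnihilatorQuotient (φ : LieAlgebra.LieCharacter ℂ p) :=
  (whittakerAnnihilator φ).toSubmodule ⧸
    p.toSubmodule.submoduleOf (whittakerAnnihilator φ).toSubmodule

/-- The universal quasi-Whittaker module `W(φ) = Ind_p^L ℂ w_φ`. -/
abbrev W (φ : LieAlgebra.LieCharacter ℂ p) := Ind (LieIdeal.incl p) (CharModule φ)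

/-- The cyclic vector `w_φ = 1 ⊗ w_φ` of `W(φ)`. -/
def wVec (φ : LieAlgebra.LieCharacter ℂ p) : W φ :=
  Ind.of (LieIdeal.incl p) (CharModule.gen φ)

/-- The module `V(φ') = Ind_{L^φ}^L ℂ v_φ'` induced from a character of `L^φ`. -/
abbrev V (φ : LieAlgebra.LieCharacter ℂ p)
    (φ' : LieAlgebra.LieCharacter ℂ (whittakerAnnihilator φ)) :=
  Ind (whittakerAnnihilator φ).incl (CharModule φ')

/-- `φ'` is an extension of `φ` to the Whittaker annihilator of `φ`. -/
def IsExtension (φ : LieAlgebra.LieCharacter ℂ p)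
    (φ' : LieAlgebra.LieCharacter ℂ (whittakerAnnihilator φ)) : Prop :=
  ∀ q : p, φ' ⟨q, mem_whittakerAnnihilator_of_mem φ q.2⟩ = φ q

/-- The ordered monomial `x^α = x_{i₁}^{α_{i₁}} ⋯ x_{iₙ}^{α_{iₙ}}` in `U(L)`, where
`i₁ < ⋯ < iₙ` is the support of `α`. -/
def orderedMonomial {I : Type*} [LinearOrder I] (x : I → L) (α : I →₀ ℕ) :
    UniversalEnvelopingAlgebra ℂ L :=
  (α.support.sort.map fun i => UniversalEnvelopingAlgebra.ι ℂ (x i) ^ α i).prod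

/-- The subspace `J_ξ` of `W(φ)` spanned by the vectors `x^α y^n (y - ξ) w_φ`. -/
def J (φ : LieAlgebra.LieCharacter ℂ p) {I : Type*} [LinearOrder I] (x : I → L) (y : L) (ξ : ℂ) :
    Submodule ℂ (W φ) :=
  Submodule.span ℂ {v | ∃ (α : I →₀ ℕ) (n : ℕ),
    v = (orderedMonomial x α * UniversalEnvelopingAlgebra.ι ℂ y ^ n *
      (UniversalEnvelopingAlgebra.ι ℂ y
        - algebraMap ℂ (UniversalEnvelopingAlgebra ℂ L) ξ)) • wVec φ}

end Whittaker

end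

end QuasiWhittaker

/-! Filter `W(φ)` by the vectors killed by all `n`-fold products of the operators `q - φ(q)`, `q ∈
p`; level one consists of the Whittaker vectors. Since `p` is an ideal, acting by an element of `L`
raises the level by at most one. If the `x_j` are independent modulo the annihilator `L^φ`, the
functionals `q ↦ φ([x_j, q])` are independent on `p`. Hence some `q - φ(q)` acts on a given finite
set of ordered monomials, applied to Whittaker vectors, as `∂/∂x_i` up to lower level.
Differentiating down from the top degree, a submodule containing `∑ x^α f_α` with Whittaker
coefficients contains every `f_α` (`mem_of_sum_mem`). This needs no linear independence of the
vectors `x^α f_α`.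

If `L^φ = p`, every vector is a sum of `x^α` applied to multiples of `w_φ`, so a nonzero submodule
contains `w_φ` and is everything. If `L^φ = ℂy ⊕ p`, the coefficients are vectors `f(y) w_φ`, which
are again Whittaker. The polynomials `f` with `f(y) w_φ` in a proper submodule form a proper ideal
of `ℂ[X]`, contained in some `(X - ξ)`; the submodule then lies in `J_ξ`. Each `J_ξ` is proper
because it is killed by the surjection onto `V(φ')`, where `φ'` extends `φ` with `φ'(y) = ξ`. The
`J_ξ` are pairwise incomparable, hence they are the maximal submodules, and the kernel of that
surjection is exactly `J_ξ`.

Two facts of Poincaré–Birkhoff–Witt type are needed: the induced modules are nonzero, and ordered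
monomials applied to a Whittaker vector span a submodule. Both come from an explicit action of `L`
on polynomials (`IsAdapted.rep`, `IsAdapted.map_act`), a model of the module induced from a
character of a subalgebra. -/

namespace QuasiWhittaker

attribute [local instance 100] LieRing.ofAssociativeRing

noncomputable section

/-! ### Recursive construction of the action on polynomials. -/

section PolynomialModule

open MvPolynomial

variable {R L I : Type*} [CommRing R] [LieRing L] [LieAlgebra R L]

variable (R I) in
/-- The polynomials of total degree at most `n`, as the span of monomials. -/
def degreeLE (n : ℕ) : Submodule R (MvPolynomial I R) :=
  Submodule.span R {m | ∃ s : I →₀ ℕ, s.degree ≤ n ∧ m = monomial s 1}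

theorem monomial_mem_degreeLE {s : I →₀ ℕ} {n : ℕ} (h : s.degree ≤ n) :
    monomial s (1 : R) ∈ degreeLE R I n :=
  Submodule.subset_span ⟨s, h, rfl⟩

theorem degreeLE_mono {m n : ℕ} (h : m ≤ n) : degreeLE R I m ≤ degreeLE R I n := by
  apply Submodule.span_mono
  rintro _ ⟨s, hs, rfl⟩
  exact ⟨s, hs.trans h, rfl⟩

theorem X_mul_monomial (i : I) (s : I →₀ ℕ) :
    (X i : MvPolynomial I R) * monomial s 1 = monomial (Finsupp.single i 1 + s) 1 := by
  rw [X, monomial_mul, one_mul]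

theorem X_mul_mem_degreeLE (i : I) {n : ℕ} {P : MvPolynomial I R} (hP : P ∈ degreeLE R I n) :
    X i * P ∈ degreeLE R I (n + 1) := by
  induction hP using Submodule.span_induction with
  | mem _ h =>
    obtain ⟨s, hs, rfl⟩ := h
    rw [X_mul_monomial]
    apply monomial_mem_degreeLE
    rw [map_add, Finsupp.degree_single]
    omega
  | zero => rw [mul_zero]; exact zero_mem _
  | add _ _ _ _ h₁ h₂ => rw [mul_add]; exact add_mem h₁ h₂
  | smul r _ _ h => rw [mul_smul_comm]; exact Submodule.smul_mem _ _ h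

theorem exists_mem_degreeLE (P : MvPolynomial I R) : ∃ n, P ∈ degreeLE R I n := by
  induction P using MvPolynomial.induction_on' with
  | monomial s a =>
    refine ⟨s.degree, ?_⟩
    have : monomial s a = a • monomial s (1 : R) := by rw [smul_monomial, smul_eq_mul, mul_one]
    rw [this]
    exact Submodule.smul_mem _ _ (monomial_mem_degreeLE le_rfl)
  | add p q hp hq =>
    obtain ⟨m, hm⟩ := hp
    obtain ⟨n, hn⟩ := hq
    exact ⟨max m n, add_mem (degreeLE_mono (le_max_left _ _) hm)
      (degreeLE_mono (le_max_right _ _) hn)⟩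

/-- Multiplication by the linear form `∑ i, c(x)ᵢ Xᵢ`. -/
def headMul (c : L →ₗ[R] I →₀ R) : L →ₗ[R] Module.End R (MvPolynomial I R) :=
  (LinearMap.mul R (MvPolynomial I R)).comp ((Finsupp.linearCombination R X).comp c)

theorem headMul_apply (c : L →ₗ[R] I →₀ R) (x : L) (P : MvPolynomial I R) :
    headMul c x P = Finsupp.linearCombination R X (c x) * P := rfl

theorem headMul_X_mul (c : L →ₗ[R] I →₀ R) (x : L) (i : I) (P : MvPolynomial I R) :
    headMul c x (X i * P) = X i * headMul c x P := by
  rw [headMul_apply, headMul_apply, mul_left_comm]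

theorem headMul_mem_degreeLE (c : L →ₗ[R] I →₀ R) (x : L) {n : ℕ} {P : MvPolynomial I R}
    (hP : P ∈ degreeLE R I n) : headMul c x P ∈ degreeLE R I (n + 1) := by
  rw [headMul_apply, Finsupp.linearCombination_apply, Finsupp.sum, Finset.sum_mul]
  refine Submodule.sum_mem _ fun i _ => ?_
  rw [smul_mul_assoc]
  exact Submodule.smul_mem _ _ (X_mul_mem_degreeLE i hP)

section LinearOrder

variable [LinearOrder I]

/-- The map that removes from `x` the components along `eᵢ` with `i ≤ j`. -/
def truncAbove (e : I → L) (c : L →ₗ[R] I →₀ R) (j : I) : L →ₗ[R] L :=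
  LinearMap.id - (Finsupp.linearCombination R fun i => if i ≤ j then e i else 0).comp c

/-- The action on polynomials of degree at most `n`, by recursion on `n`. -/
def actAux (e : I → L) (c : L →ₗ[R] I →₀ R) (χ : L →ₗ[R] R) :
    ℕ → L →ₗ[R] Module.End R (MvPolynomial I R)
  | 0 => headMul c + χ.smulRight LinearMap.id
  | n + 1 => LinearMap.flip <| (basisMonomials I R).constr R fun s =>
      if h : s.support.Nonempty ∧ n < s.degree then
        -- The recursion is forced by the bracket relation. Components of `x` along `eᵢ`, `i ≤ j`,
        -- only multiply by `Xᵢ`. The rest `x'` must satisfy `x'(e_j t) = e_j(x' t) + [x', e_j] t`.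
        -- The leading part of `x' t` involves only variables at or above `j`, so `e_j` multiplies
        -- it by `X_j`; the remainder has degree at most `n`, where the previous level is available.
        let j := s.support.min' h.1
        let t := s - Finsupp.single j 1
        (headMul c).flip (monomial s 1)
          + (actAux e c χ n (e j) ∘ₗ (actAux e c χ n - headMul c).flip (monomial t 1)
              + (actAux e c χ n).flip (monomial t 1) ∘ₗ (-LieAlgebra.ad R L (e j) : Module.End R L))
            ∘ₗ truncAbove e c j
      else (actAux e c χ n).flip (monomial s 1)

variable {e : I → L} {c : L →ₗ[R] I →₀ R} {χ : L →ₗ[R] R}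

theorem actAux_succ_of_le {n : ℕ} {s : I →₀ ℕ} (hs : s.degree ≤ n) (x : L) :
    actAux e c χ (n + 1) x (monomial s 1) = actAux e c χ n x (monomial s 1) := by
  have := (basisMonomials I R).constr_basis R (M' := L →ₗ[R] MvPolynomial I R)
  simp only [coe_basisMonomials] at this
  rw [actAux, LinearMap.flip_apply, this, dif_neg (by omega), LinearMap.flip_apply]

theorem actAux_succ {n : ℕ} {j : I} {t : I →₀ ℕ} (ht : t.degree = n)
    (hj : ∀ i ∈ t.support, j ≤ i) (x : L) :
    actAux e c χ (n + 1) x (X j * monomial t 1) =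
      headMul c x (X j * monomial t 1)
        + actAux e c χ n (e j) (actAux e c χ n (truncAbove e c j x) (monomial t 1)
            - headMul c (truncAbove e c j x) (monomial t 1))
        + actAux e c χ n ⁅truncAbove e c j x, e j⁆ (monomial t 1) := by
  have := (basisMonomials I R).constr_basis R (M' := L →ₗ[R] MvPolynomial I R)
  simp only [coe_basisMonomials] at this
  have hj' : j ∈ (Finsupp.single j 1 + t).support := by simp
  have hne : (Finsupp.single j 1 + t).support.Nonempty := ⟨j, hj'⟩
  have hmin : (Finsupp.single j 1 + t).support.min' hne = j := by
    refine le_antisymm (Finset.min'_le _ _ hj') (Finset.le_min' _ _ _ fun i hi => ?_)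
    rcases Finset.mem_union.1 (Finsupp.support_add hi) with h | h
    · have := Finsupp.support_single_subset h
      rw [Finset.mem_singleton.1 this]
    · exact hj i h
  have hdeg : n < (Finsupp.single j 1 + t).degree := by
    rw [map_add, Finsupp.degree_single]; omega
  rw [X_mul_monomial, actAux, LinearMap.flip_apply, this, dif_pos ⟨hne, hdeg⟩]
  simp only [hmin, add_tsub_cancel_left, LinearMap.add_apply, LinearMap.flip_apply,
    LinearMap.comp_apply, LinearMap.sub_apply, LinearMap.neg_apply, LieAlgebra.ad_apply,
    lie_skew, add_assoc]

variable (e c χ) in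
/-- The action of `L` on polynomials. -/
def act : L →ₗ[R] Module.End R (MvPolynomial I R) :=
  LinearMap.flip <| (basisMonomials I R).constr R fun s =>
    (actAux e c χ s.degree).flip (monomial s 1)

theorem act_monomial (x : L) (s : I →₀ ℕ) :
    act e c χ x (monomial s 1) = actAux e c χ s.degree x (monomial s 1) := by
  have := (basisMonomials I R).constr_basis R (M' := L →ₗ[R] MvPolynomial I R)
  simp only [coe_basisMonomials] at this
  rw [act, LinearMap.flip_apply, this, LinearMap.flip_apply]

theorem actAux_eq_act {n : ℕ} (x : L) {P : MvPolynomial I R} (hP : P ∈ degreeLE R I n) :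
    actAux e c χ n x P = act e c χ x P := by
  refine LinearMap.eqOn_span (s := {m | ∃ s : I →₀ ℕ, s.degree ≤ n ∧ m = monomial s (1 : R)})
    ?_ hP
  rintro _ ⟨s, hs, rfl⟩
  rw [act_monomial]
  obtain ⟨k, rfl⟩ := Nat.exists_eq_add_of_le hs
  clear hP hs
  induction k with
  | zero => rfl
  | succ k ih => rw [← add_assoc, actAux_succ_of_le (Nat.le_add_right _ _), ih]

theorem exists_head (s : I →₀ ℕ) (hs : s ≠ 0) :
    ∃ (j : I) (t : I →₀ ℕ), (∀ i ∈ t.support, j ≤ i) ∧ s = Finsupp.single j 1 + t := by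
  have hne : s.support.Nonempty := Finsupp.support_nonempty_iff.2 hs
  refine ⟨s.support.min' hne, s - Finsupp.single (s.support.min' hne) 1, fun i hi => ?_, ?_⟩
  · exact Finset.min'_le _ _ (Finsupp.support_mono tsub_le_self hi)
  · rw [add_tsub_cancel_of_le]
    rw [Finsupp.single_le_iff, Nat.one_le_iff_ne_zero, ← Finsupp.mem_support_iff]
    exact Finset.min'_mem _ _

/-- `act` differs from multiplication by the leading linear form by terms of no higher degree. -/
theorem actAux_sub_headMul_mem (n : ℕ) (x : L) (s : I →₀ ℕ) (hs : s.degree ≤ n) :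
    actAux e c χ n x (monomial s 1) - headMul c x (monomial s 1) ∈ degreeLE R I s.degree := by
  induction n generalizing x s with
  | zero =>
    rw [actAux, LinearMap.add_apply, LinearMap.add_apply, add_sub_cancel_left]
    exact Submodule.smul_mem _ _ (monomial_mem_degreeLE le_rfl)
  | succ n ih =>
    rcases Nat.lt_or_ge n s.degree with h | h
    · obtain ⟨j, t, hj, rfl⟩ := exists_head s (by rintro rfl; simp at h)
      rw [map_add, Finsupp.degree_single] at *
      have ht : t.degree = n := by omega
      have key : ∀ (z : L) {P : MvPolynomial I R}, P ∈ degreeLE R I n →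
          actAux e c χ n z P ∈ degreeLE R I (1 + t.degree) := by
        intro z P hP
        induction hP using Submodule.span_induction with
        | mem _ h =>
          obtain ⟨s, hs, rfl⟩ := h
          rw [← sub_add_cancel (actAux e c χ n z (monomial s 1)) (headMul c z (monomial s 1))]
          exact add_mem (degreeLE_mono (by omega) (ih z s hs))
            (degreeLE_mono (by omega) (headMul_mem_degreeLE c z (monomial_mem_degreeLE hs)))
        | zero => rw [map_zero]; exact zero_mem _
        | add _ _ _ _ h₁ h₂ => rw [map_add]; exact add_mem h₁ h₂
        | smul r _ _ h => rw [map_smul]; exact Submodule.smul_mem _ _ h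
      rw [← X_mul_monomial, actAux_succ ht hj, add_assoc, add_sub_cancel_left]
      exact add_mem (key _ (degreeLE_mono ht.le (ih _ _ ht.le)))
        (key _ (monomial_mem_degreeLE ht.le))
    · rw [actAux_succ_of_le h]
      exact ih x s h

theorem act_sub_headMul_mem (x : L) (s : I →₀ ℕ) :
    act e c χ x (monomial s 1) - headMul c x (monomial s 1) ∈ degreeLE R I s.degree := by
  rw [act_monomial]
  exact actAux_sub_headMul_mem _ x s le_rfl

theorem act_one (x : L) : act e c χ x 1 = headMul c x 1 + χ x • 1 := by
  have := act_monomial (e := e) (c := c) (χ := χ) x 0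
  rw [map_zero] at this
  exact this

/-- The levels of the recursion disappear: each inner action meets only polynomials of degree at
most `t.degree`, on which level `t.degree` already agrees with `act`. -/
theorem act_X_mul {j : I} {t : I →₀ ℕ} (hj : ∀ i ∈ t.support, j ≤ i) (x : L) :
    act e c χ x (X j * monomial t 1) =
      headMul c x (X j * monomial t 1)
        + act e c χ (e j) (act e c χ (truncAbove e c j x) (monomial t 1)
            - headMul c (truncAbove e c j x) (monomial t 1))
        + act e c χ ⁅truncAbove e c j x, e j⁆ (monomial t 1) := by
  have ht : (Finsupp.single j 1 + t).degree = t.degree + 1 := by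
    rw [map_add, Finsupp.degree_single, add_comm]
  rw [X_mul_monomial, act_monomial, ht, ← X_mul_monomial, actAux_succ rfl hj, act_monomial,
    act_monomial, actAux_eq_act _ (actAux_sub_headMul_mem _ _ _ le_rfl)]

end LinearOrder

end PolynomialModule

/-! ### The action is a representation, and its universal property. -/

section PolynomialModule

open MvPolynomial

variable {R L I : Type*} [CommRing R] [LieRing L] [LieAlgebra R L]

/-- The functions `c` are coordinates along the family `e`, the common kernel `H` of the
coordinates is a subalgebra, and `χ` restricts to a character of `H`. -/
structure IsAdapted (e : I → L) (c : L →ₗ[R] I →₀ R) (χ : L →ₗ[R] R) : Prop where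
  coord_apply : ∀ i, c (e i) = Finsupp.single i 1
  coord_lie : ∀ a b, c a = 0 → c b = 0 → c ⁅a, b⁆ = 0
  char_apply : ∀ i, χ (e i) = 0
  char_lie : ∀ a b, c a = 0 → c b = 0 → χ ⁅a, b⁆ = 0

variable {e : I → L} {c : L →ₗ[R] I →₀ R} {χ : L →ₗ[R] R}

theorem IsAdapted.headMul_apply_head (h : IsAdapted e c χ) (i : I) (P : MvPolynomial I R) :
    headMul c (e i) P = X i * P := by
  rw [headMul_apply, h.coord_apply, Finsupp.linearCombination_single, one_smul]

theorem IsAdapted.exists_coord_sub_eq_zero (h : IsAdapted e c χ) (x : L) :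
    ∃ a ∈ Submodule.span R (Set.range e), c (x - a) = 0 := by
  refine ⟨Finsupp.linearCombination R e (c x), ?_, ?_⟩
  · rw [Finsupp.linearCombination_apply]
    exact Submodule.sum_mem _ fun i _ => Submodule.smul_mem _ _ (Submodule.subset_span ⟨i, rfl⟩)
  · rw [map_sub, sub_eq_zero, ← LinearMap.comp_apply]
    conv_lhs => rw [← LinearMap.id_apply (R := R) (c x)]
    congr 1
    ext i : 2
    simp [h.coord_apply]

variable [LinearOrder I]

theorem sub_truncAbove (j : I) (x : L) :
    x - truncAbove e c j x =
      Finsupp.linearCombination R (fun i => if i ≤ j then e i else 0) (c x) := by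
  simp [truncAbove]

theorem truncAbove_of_forall {j : I} {x : L} (hx : ∀ i ≤ j, c x i = 0) :
    truncAbove e c j x = x := by
  rw [eq_comm, ← sub_eq_zero, sub_truncAbove, Finsupp.linearCombination_apply]
  refine Finset.sum_eq_zero fun i _ => ?_
  dsimp only
  split_ifs with h
  · rw [hx i h, zero_smul]
  · rw [smul_zero]

/-- The difference is a combination of the `eᵢ` with `i ≤ j`. Linear identities in `x` thus reduce
to those `eᵢ` and to truncated elements. -/
theorem map_sub_truncAbove {M : Type*} [AddCommGroup M] [Module R M] (f : L →ₗ[R] M) {j : I}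
    (hf : ∀ i ≤ j, f (e i) = 0) (x : L) : f (x - truncAbove e c j x) = 0 := by
  rw [sub_truncAbove, Finsupp.linearCombination_apply, Finsupp.sum, map_sum]
  refine Finset.sum_eq_zero fun i _ => ?_
  rw [map_smul]
  split_ifs with h
  · rw [hf i h, smul_zero]
  · rw [map_zero, smul_zero]

namespace IsAdapted

theorem coord_truncAbove (h : IsAdapted e c χ) {i j : I} (hij : i ≤ j) (x : L) :
    c (truncAbove e c j x) i = 0 := by
  have h₁ : c (truncAbove e c j x) i = c x i - c (x - truncAbove e c j x) i := by
    rw [map_sub, Finsupp.sub_apply, sub_sub_cancel]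
  have h₂ : ∀ k, Finsupp.lapply (R := R) i (c (if k ≤ j then e k else 0))
      = if k = i then 1 else 0 := by
    intro k
    split_ifs with h3 h4 h4
    · subst h4; simp [h.coord_apply]
    · simp [h.coord_apply, h4]
    · exact absurd (h4 ▸ hij) h3
    · simp
  rw [h₁, sub_truncAbove, sub_eq_zero]
  change _ = (Finsupp.lapply (R := R) i) (c _)
  rw [Finsupp.linearCombination_apply, Finsupp.sum, map_sum, map_sum]
  simp only [map_smul, h₂]
  simp [eq_comm]

theorem coord_head (h : IsAdapted e c χ) {i j : I} (hij : j < i) : ∀ k ≤ j, c (e i) k = 0 := by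
  intro k hk
  rw [h.coord_apply, Finsupp.single_eq_of_ne (hk.trans_lt hij).ne]

theorem truncAbove_head (h : IsAdapted e c χ) {i j : I} (hij : i ≤ j) :
    truncAbove e c j (e i) = 0 := by
  simp [truncAbove, h.coord_apply, hij]

theorem act_head (h : IsAdapted e c χ) {j : I} {s : I →₀ ℕ} (hj : ∀ i ∈ s.support, j ≤ i) :
    act e c χ (e j) (monomial s 1) = X j * monomial s 1 := by
  rcases eq_or_ne s 0 with rfl | hs
  · have := act_one (e := e) (c := c) (χ := χ) (e j)
    rw [h.char_apply, zero_smul, add_zero, h.headMul_apply_head] at this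
    exact this
  · obtain ⟨k, t, hk, rfl⟩ := exists_head s hs
    have hjk : j ≤ k := hj k (by simp)
    rw [← X_mul_monomial, act_X_mul hk, h.truncAbove_head hjk, h.headMul_apply_head]
    simp

/-- `act (e j)` multiplies by `X j` a product whose head is a linear form in the `X i`, `i > j`. -/
theorem act_head_headMul (h : IsAdapted e c χ) {j : I} {s : I →₀ ℕ}
    (hj : ∀ i ∈ s.support, j ≤ i) {x : L} (hx : ∀ i ≤ j, c x i = 0) :
    act e c χ (e j) (headMul c x (monomial s 1)) = X j * headMul c x (monomial s 1) := by
  rw [headMul_apply, Finsupp.linearCombination_apply, Finsupp.sum, Finset.sum_mul, map_sum,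
    Finset.mul_sum]
  refine Finset.sum_congr rfl fun i _ => ?_
  rw [smul_mul_assoc, map_smul, mul_smul_comm]
  rcases le_or_gt i j with hij | hij
  · rw [hx i hij, zero_smul, zero_smul]
  · rw [X_mul_monomial, h.act_head]
    intro k hk
    rcases Finset.mem_union.1 (Finsupp.support_add hk) with hk | hk
    · rw [Finset.mem_singleton.1 (Finsupp.support_single_subset hk)]; exact hij.le
    · exact hj k hk

end IsAdapted

variable (e c χ) in
/-- The map `x ↦ x(yP) - y(xP) - [x,y]P`. -/
def bracketDefect (y : L) (P : MvPolynomial I R) : L →ₗ[R] MvPolynomial I R :=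
  (act e c χ).flip (act e c χ y P) - act e c χ y ∘ₗ (act e c χ).flip P
    + (act e c χ).flip P ∘ₗ LieAlgebra.ad R L y

theorem bracketDefect_apply (x y : L) (P : MvPolynomial I R) :
    bracketDefect e c χ y P x =
      act e c χ x (act e c χ y P) - act e c χ y (act e c χ x P) - act e c χ ⁅x, y⁆ P := by
  rw [bracketDefect, ← lie_skew, map_neg]
  simp

theorem bracketDefect_skew (x y : L) (P : MvPolynomial I R) :
    bracketDefect e c χ y P x = -bracketDefect e c χ x P y := by
  rw [bracketDefect_apply, bracketDefect_apply, ← lie_skew, map_neg, LinearMap.neg_apply]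
  abel

theorem bracketDefect_eq_zero_iff {x y : L} {P : MvPolynomial I R} :
    bracketDefect e c χ y P x = 0 ↔
      act e c χ x (act e c χ y P) = act e c χ y (act e c χ x P) + act e c χ ⁅x, y⁆ P := by
  rw [bracketDefect_apply, sub_sub, sub_eq_zero]

theorem bracketDefect_eq_zero_of_forall {x y : L} {p : MvPolynomial I R → Prop}
    (hp : ∀ P, p P → bracketDefect e c χ y P x = 0) {P : MvPolynomial I R}
    (hP : P ∈ Submodule.span R {P | p P}) : bracketDefect e c χ y P x = 0 := by
  induction hP using Submodule.span_induction with
  | mem P h => exact hp P h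
  | zero => simp [bracketDefect_apply]
  | add P Q _ _ h₁ h₂ =>
    rw [bracketDefect_eq_zero_iff] at *
    simp only [map_add, h₁, h₂]
    abel
  | smul r P _ h =>
    rw [bracketDefect_eq_zero_iff] at *
    simp only [map_smul, h, smul_add]

/-- To check the bracket relation it suffices to do so for `x` and `y` without components along
`eᵢ`, `i ≤ j`, and for `eᵢ`, `i ≤ j`. -/
theorem bracketDefect_eq_zero_of_truncAbove {j : I} {P : MvPolynomial I R}
    (h₁ : ∀ (x : L), ∀ i ≤ j, bracketDefect e c χ (e i) P x = 0)
    (h₂ : ∀ x y, bracketDefect e c χ (truncAbove e c j y) P (truncAbove e c j x) = 0) (x y : L) :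
    bracketDefect e c χ y P x = 0 := by
  have key : ∀ y, (∀ x, bracketDefect e c χ y P (truncAbove e c j x) = 0) →
      ∀ x, bracketDefect e c χ y P x = 0 := by
    intro y hy x
    rw [← sub_add_cancel x (truncAbove e c j x), map_add, hy, add_zero]
    refine map_sub_truncAbove _ (fun i hi => ?_) x
    rw [bracketDefect_skew, h₁ y i hi, neg_zero]
  refine key y (fun x => ?_) x
  rw [bracketDefect_skew, neg_eq_zero]
  exact key _ (fun y => by rw [bracketDefect_skew, h₂, neg_zero]) y

/-- The two kinds of monomials are those on which the bracket relation with `e k` is available: by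
induction on the degree, or because `k` is minimal. -/
theorem act_monomial_mem_span {k : I} {t : I →₀ ℕ} (hk : ∀ i ∈ t.support, k ≤ i) {y : L}
    (hy : ∀ i ≤ k, c y i = 0) :
    act e c χ y (monomial t 1) ∈ Submodule.span R
      {P | ∃ s : I →₀ ℕ, (s.degree ≤ t.degree ∨ ∀ i ∈ s.support, k ≤ i) ∧ P = monomial s 1} := by
  rw [← sub_add_cancel (act e c χ y (monomial t 1)) (headMul c y (monomial t 1))]
  refine add_mem (Submodule.span_mono ?_ (act_sub_headMul_mem y t)) ?_
  · rintro _ ⟨s, hs, rfl⟩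
    exact ⟨s, Or.inl hs, rfl⟩
  · rw [headMul_apply, Finsupp.linearCombination_apply, Finsupp.sum, Finset.sum_mul]
    refine Submodule.sum_mem _ fun i _ => ?_
    rw [smul_mul_assoc, X_mul_monomial]
    rcases le_or_gt i k with hik | hik
    · rw [hy i hik, zero_smul]; exact zero_mem _
    · refine Submodule.smul_mem _ _ (Submodule.subset_span ⟨_, Or.inr fun l hl => ?_, rfl⟩)
      rcases Finset.mem_union.1 (Finsupp.support_add hl) with hl | hl
      · rw [Finset.mem_singleton.1 (Finsupp.support_single_subset hl)]; exact hik.le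
      · exact hk l hl

namespace IsAdapted

/-- For such `x` the recursive formula for the action on `X j * monomial s 1` is itself the bracket
relation. -/
theorem bracketDefect_head_of_lt (h : IsAdapted e c χ) {j : I} {s : I →₀ ℕ}
    (hj : ∀ i ∈ s.support, j ≤ i) {x : L} (hx : ∀ i ≤ j, c x i = 0) :
    bracketDefect e c χ (e j) (monomial s 1) x = 0 := by
  rw [bracketDefect_eq_zero_iff, h.act_head hj, act_X_mul hj, truncAbove_of_forall hx, map_sub,
    h.act_head_headMul hj hx, headMul_X_mul, add_sub_cancel]

theorem bracketDefect_head (h : IsAdapted e c χ) {j : I} {s : I →₀ ℕ}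
    (hj : ∀ i ∈ s.support, j ≤ i) (x : L) :
    bracketDefect e c χ (e j) (monomial s 1) x = 0 := by
  rw [← sub_add_cancel x (truncAbove e c j x), map_add,
    h.bracketDefect_head_of_lt hj fun i hi => h.coord_truncAbove hi x, add_zero]
  refine map_sub_truncAbove _ (fun i hi => ?_) x
  rcases hi.lt_or_eq with hi | rfl
  · rw [bracketDefect_skew, h.bracketDefect_head_of_lt (fun k hk => hi.le.trans (hj k hk))
      (h.coord_head hi), neg_zero]
  · rw [bracketDefect_apply, lie_self, map_zero, LinearMap.zero_apply, sub_self, sub_zero]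

theorem act_of_coord_eq_zero (_ : IsAdapted e c χ) {x : L} (hx : c x = 0) :
    act e c χ x 1 = χ x • 1 := by
  rw [act_one, headMul_apply, hx, map_zero, zero_mul, zero_add]

/-- Modulo the `eᵢ`, both elements lie in the kernel of `c`, which acts on `1` by scalars; scalars
commute and `χ` vanishes on brackets of that kernel. -/
theorem bracketDefect_one (h : IsAdapted e c χ) (x y : L) :
    bracketDefect e c χ y 1 x = 0 := by
  have h₁ : ∀ (x : L) (i : I), bracketDefect e c χ (e i) 1 x = 0 := fun x i =>
    h.bracketDefect_head (s := 0) (by simp) x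
  obtain ⟨a, hfa, ha⟩ := h.exists_coord_sub_eq_zero x
  obtain ⟨b, hfb, hb⟩ := h.exists_coord_sub_eq_zero y
  have hs : ∀ a ∈ Submodule.span R (Set.range e), ∀ f : L →ₗ[R] MvPolynomial I R,
      (∀ i, f (e i) = 0) → f a = 0 := fun a ha f hf => by
    have : Submodule.span R (Set.range e) ≤ LinearMap.ker f :=
      Submodule.span_le.2 (Set.range_subset_iff.2 hf)
    exact this ha
  have h₂ : ∀ x, bracketDefect e c χ b 1 x = 0 := fun x => by
    rw [bracketDefect_skew, hs _ hfb _ fun i => by rw [bracketDefect_skew, h₁, neg_zero], neg_zero]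
  rw [← sub_add_cancel x a, map_add, hs _ hfa _ fun i => by rw [bracketDefect_skew, h₁, neg_zero],
    add_zero, bracketDefect_skew, ← sub_add_cancel y b, map_add,
    bracketDefect_skew b, h₂, neg_zero, add_zero, bracketDefect_skew (y - b), neg_neg,
    bracketDefect_eq_zero_iff, h.act_of_coord_eq_zero ha, h.act_of_coord_eq_zero hb,
    h.act_of_coord_eq_zero (h.coord_lie _ _ ha hb), h.char_lie _ _ ha hb, zero_smul, add_zero,
    map_smul, map_smul, h.act_of_coord_eq_zero ha, h.act_of_coord_eq_zero hb, smul_comm]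

theorem bracketDefect_monomial (h : IsAdapted e c χ) (n : ℕ) (s : I →₀ ℕ) (hs : s.degree = n)
    (x y : L) : bracketDefect e c χ y (monomial s 1) x = 0 := by
  induction n using Nat.strong_induction_on generalizing s x y with
  | _ n ih =>
  rcases eq_or_ne s 0 with rfl | hs0
  · exact h.bracketDefect_one x y
  obtain ⟨k, t, hk, rfl⟩ := exists_head s hs0
  have ht : t.degree < n := by
    rw [map_add, Finsupp.degree_single] at hs; omega
  have hk' : ∀ i ∈ (Finsupp.single k 1 + t).support, k ≤ i := by
    intro i hi
    rcases Finset.mem_union.1 (Finsupp.support_add hi) with hi | hi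
    · rw [Finset.mem_singleton.1 (Finsupp.support_single_subset hi)]
    · exact hk i hi
  refine bracketDefect_eq_zero_of_truncAbove (j := k)
    (fun x i hi => h.bracketDefect_head (fun l hl => hi.trans (hk' l hl)) x) (fun x y => ?_) x y
  have hx : ∀ i ≤ k, c (truncAbove e c k x) i = 0 := fun i hi => h.coord_truncAbove hi x
  have hy : ∀ i ≤ k, c (truncAbove e c k y) i = 0 := fun i hi => h.coord_truncAbove hi y
  generalize truncAbove e c k x = x at *
  generalize truncAbove e c k y = y at *
  -- the bracket of `x` and `e k` on `y z` for a monomial `z` of lower degree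
  have key : ∀ x y : L, (∀ i ≤ k, c y i = 0) →
      act e c χ x (act e c χ (e k) (act e c χ y (monomial t 1))) =
        act e c χ (e k) (act e c χ x (act e c χ y (monomial t 1)))
          + act e c χ ⁅x, e k⁆ (act e c χ y (monomial t 1)) := by
    intro x y hy
    rw [← bracketDefect_eq_zero_iff]
    let p : MvPolynomial I R → Prop := fun P => bracketDefect e c χ (e k) P x = 0
    refine bracketDefect_eq_zero_of_forall (p := p) (fun _ hP => hP) ?_
    refine Submodule.span_mono ?_ (act_monomial_mem_span hk hy)
    rintro _ ⟨s, hs | hs, rfl⟩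
    · exact ih _ (hs.trans_lt ht) s rfl _ _
    · exact h.bracketDefect_head hs x
  have ih' : ∀ x y, act e c χ x (act e c χ y (monomial t 1)) =
      act e c χ y (act e c χ x (monomial t 1)) + act e c χ ⁅x, y⁆ (monomial t 1) := fun x y =>
    bracketDefect_eq_zero_iff.1 (ih _ ht t rfl x y)
  -- Write the monomial as `e k` applied to `t` and move `e k` to the left on both sides. What
  -- remains is the Jacobi identity for `x`, `y`, `e k`, acting on `t`.
  rw [bracketDefect_eq_zero_iff, ← X_mul_monomial, ← h.act_head hk, ih' y, ih' x, map_add,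
    map_add, key x y hy, key y x hx, ih' x ⁅y, e k⁆, ih' y ⁅x, e k⁆, ih' ⁅x, y⁆,
    ih' x y, leibniz_lie x y (e k), map_add, map_add, LinearMap.add_apply]
  abel

/-- The Lie algebra representation `act`. -/
def rep (h : IsAdapted e c χ) : L →ₗ⁅R⁆ Module.End R (MvPolynomial I R) where
  toLinearMap := act e c χ
  map_lie' {x y} := by
    refine (basisMonomials I R).ext fun s => ?_
    have := bracketDefect_eq_zero_iff.1 (h.bracketDefect_monomial _ s rfl x y)
    rw [LieRing.of_associative_ring_bracket, coe_basisMonomials]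
    exact (sub_eq_of_eq_add' this).symm

end IsAdapted

/-- The polynomial module is universal among representations with a vector on which the common
kernel of the coordinates acts through `χ`. -/
theorem IsAdapted.map_act (h : IsAdapted e c χ) {V : Type*} [AddCommGroup V] [Module R V]
    (ρ : L →ₗ⁅R⁆ Module.End R V) (θ : MvPolynomial I R →ₗ[R] V)
    (hθ : ∀ a, c a = 0 → ρ a (θ 1) = χ a • θ 1)
    (hhead : ∀ (j : I) (s : I →₀ ℕ), (∀ i ∈ s.support, j ≤ i) →
      θ (X j * monomial s 1) = ρ (e j) (θ (monomial s 1)))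
    (x : L) (P : MvPolynomial I R) : θ (act e c χ x P) = ρ x (θ P) := by
  let δ : MvPolynomial I R → L →ₗ[R] V := fun P =>
    θ ∘ₗ (act e c χ).flip P - (ρ : L →ₗ[R] Module.End R V).flip (θ P)
  have hδ : ∀ P x, δ P x = θ (act e c χ x P) - ρ x (θ P) := fun P x => rfl
  have hδ0 : ∀ {P x}, δ P x = 0 ↔ θ (act e c χ x P) = ρ x (θ P) := sub_eq_zero
  have hspan : ∀ (x : L) (p : MvPolynomial I R → Prop), (∀ P, p P → δ P x = 0) →
      ∀ P ∈ Submodule.span R {P | p P}, δ P x = 0 := by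
    intro x p hp P hP
    induction hP using Submodule.span_induction with
    | mem P h => exact hp P h
    | zero => simp [hδ]
    | add P Q _ _ h₁ h₂ => rw [hδ0] at *; simp only [map_add, h₁, h₂]
    | smul r P _ h => rw [hδ0] at *; simp only [map_smul, h]
  have hh : ∀ (j : I) (s : I →₀ ℕ), (∀ i ∈ s.support, j ≤ i) → δ (monomial s 1) (e j) = 0 := by
    intro j s hj
    rw [hδ0, h.act_head hj, hhead j s hj]
  have hmon : ∀ (n : ℕ) (s : I →₀ ℕ), s.degree = n → ∀ x, δ (monomial s 1) x = 0 := by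
    intro n
    induction n using Nat.strong_induction_on with
    | _ n ih =>
    intro s hs x
    rcases eq_or_ne s 0 with rfl | hs0
    · obtain ⟨a, ha, hxa⟩ := h.exists_coord_sub_eq_zero x
      have h₁ : Submodule.span R (Set.range e) ≤ LinearMap.ker (δ 1) :=
        Submodule.span_le.2 (Set.range_subset_iff.2 fun i => hh i 0 (by simp))
      change δ 1 x = 0
      rw [← sub_add_cancel x a, map_add, LinearMap.mem_ker.1 (h₁ ha), add_zero, hδ0,
        h.act_of_coord_eq_zero hxa, map_smul, hθ _ hxa]
    · obtain ⟨k, t, hk, rfl⟩ := exists_head s hs0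
      have ht : t.degree < n := by
        rw [map_add, Finsupp.degree_single] at hs; omega
      have hk' : ∀ i ∈ (Finsupp.single k 1 + t).support, k ≤ i := by
        intro i hi
        rcases Finset.mem_union.1 (Finsupp.support_add hi) with hi | hi
        · rw [Finset.mem_singleton.1 (Finsupp.support_single_subset hi)]
        · exact hk i hi
      rw [← sub_add_cancel x (truncAbove e c k x), map_add,
        map_sub_truncAbove _ (fun i hi => hh i _ fun l hl => hi.trans (hk' l hl)), zero_add]
      have hx : ∀ i ≤ k, c (truncAbove e c k x) i = 0 := fun i hi => h.coord_truncAbove hi x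
      generalize truncAbove e c k x = x at *
      -- As for the bracket relation, `x` applied to `t` splits into terms of lower degree than the
      -- full monomial and terms with all variables at or above `k`, so `θ` commutes with `e k` on
      -- it.
      have h₁ : δ (act e c χ x (monomial t 1)) (e k) = 0 := by
        refine hspan _ _ ?_ _ (act_monomial_mem_span hk hx)
        rintro _ ⟨s, hs | hs, rfl⟩
        · exact ih _ (hs.trans_lt ht) s rfl _
        · exact hh k s hs
      rw [hδ0] at h₁ ⊢
      rw [← X_mul_monomial, hhead k t hk, ← h.act_head hk,
        bracketDefect_eq_zero_iff.1 (h.bracketDefect_monomial _ t rfl x (e k)), map_add, h₁,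
        hδ0.1 (ih _ ht t rfl x), hδ0.1 (ih _ ht t rfl _), LieHom.map_lie,
        LieRing.of_associative_ring_bracket, LinearMap.sub_apply, Module.End.mul_apply,
        Module.End.mul_apply, add_sub_cancel]
  obtain ⟨n, hn⟩ := exists_mem_degreeLE P
  refine hδ0.1 (hspan x _ ?_ P hn)
  rintro _ ⟨s, -, rfl⟩
  exact hmon _ s rfl x

end PolynomialModule

/-! ### Enveloping algebras and the universal property of induced modules. -/

section Enveloping

variable {R L : Type*} [CommRing R] [LieRing L] [LieAlgebra R L]

local notation "U" => UniversalEnvelopingAlgebra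

theorem adjoin_range_ι :
    Algebra.adjoin R (Set.range (UniversalEnvelopingAlgebra.ι R (L := L))) = ⊤ := by
  let A := Algebra.adjoin R (Set.range (UniversalEnvelopingAlgebra.ι R (L := L)))
  let g : L →ₗ⁅R⁆ A :=
    { ((UniversalEnvelopingAlgebra.ι R (L := L)) : L →ₗ[R] U R L).codRestrict
        (Subalgebra.toSubmodule A) (fun x => Algebra.subset_adjoin ⟨x, rfl⟩) with
      map_lie' := fun {x y} => Subtype.ext (LieHom.map_lie _ x y) }
  have h : A.val.comp (UniversalEnvelopingAlgebra.lift R g) = AlgHom.id R _ := by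
    ext x
    change ((UniversalEnvelopingAlgebra.lift R g (UniversalEnvelopingAlgebra.ι R x) : A) : U R L) = _
    rw [UniversalEnvelopingAlgebra.lift_ι_apply]
    rfl
  refine (Algebra.eq_top_iff).2 fun u => ?_
  have := DFunLike.congr_fun h u
  change ((UniversalEnvelopingAlgebra.lift R g u : A) : U R L) = u at this
  rw [← this]
  exact Subtype.property _

/-- A subspace stable under `L` is stable under `U(L)`. -/
theorem smul_mem_of_forall_ι {V : Type*} [AddCommGroup V] [Module R V] [Module (U R L) V]
    [IsScalarTower R (U R L) V] (N : Submodule R V)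
    (hN : ∀ (x : L), ∀ v ∈ N, UniversalEnvelopingAlgebra.ι R x • v ∈ N) (u : U R L) {v : V}
    (hv : v ∈ N) : u • v ∈ N := by
  have hu : u ∈ Algebra.adjoin R (Set.range (UniversalEnvelopingAlgebra.ι R (L := L))) := by
    rw [adjoin_range_ι]; trivial
  induction hu using Algebra.adjoin_induction generalizing v with
  | mem _ h => obtain ⟨x, rfl⟩ := h; exact hN x v hv
  | algebraMap r => rw [algebraMap_smul]; exact N.smul_mem r hv
  | add _ _ _ _ h₁ h₂ => rw [add_smul]; exact N.add_mem (h₁ hv) (h₂ hv)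
  | mul _ _ _ _ h₁ h₂ => rw [mul_smul]; exact h₁ (h₂ hv)

end Enveloping

section Induced

variable {R H L : Type*} [CommRing R] [LieRing H] [LieAlgebra R H] [LieRing L] [LieAlgebra R L]

local notation "U" => UniversalEnvelopingAlgebra

variable {f : H →ₗ⁅R⁆ L} {χ : LieAlgebra.LieCharacter R H}

theorem Ind.ι_smul {M : Type*} [AddCommGroup M] [Module R M] [LieRingModule H M]
    [LieModule R H M] (x : L) (v : Ind f M) : UniversalEnvelopingAlgebra.ι R x • v = ⁅x, v⁆ := rfl

theorem Ind.smul_mem {M : Type*} [AddCommGroup M] [Module R M] [LieRingModule H M]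
    [LieModule R H M] (N : LieSubmodule R L (Ind f M)) (u : U R L) {v : Ind f M} (hv : v ∈ N) :
    u • v ∈ N :=
  smul_mem_of_forall_ι N.toSubmodule (fun x _ hv => N.lie_mem (x := x) hv) u hv

/-- The canonical generator of the module induced from a character. -/
def Ind.gen (f : H →ₗ⁅R⁆ L) (χ : LieAlgebra.LieCharacter R H) : Ind f (CharModule χ) :=
  Ind.of f (CharModule.gen χ)

theorem Ind.ι_smul_gen (a : H) :
    UniversalEnvelopingAlgebra.ι R (f a) • Ind.gen f χ = χ a • Ind.gen f χ := by
  have h₁ : UniversalEnvelopingAlgebra.ι R (f a) • Ind.gen f χ =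
      Submodule.Quotient.mk (UniversalEnvelopingAlgebra.ι R (f a) ⊗ₜ[R] CharModule.gen χ) := by
    change Submodule.Quotient.mk
      (UniversalEnvelopingAlgebra.ι R (f a) • ((1 : U R L) ⊗ₜ[R] CharModule.gen χ)) = _
    rw [TensorProduct.smul_tmul', smul_eq_mul, mul_one]
  have h₂ : χ a • Ind.gen f χ =
      Submodule.Quotient.mk ((1 : U R L) ⊗ₜ[R] (χ a • CharModule.gen χ)) := by
    rw [TensorProduct.tmul_smul]
    rfl
  rw [h₁, h₂]
  refine (Submodule.Quotient.eq _).2 (Submodule.subset_span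
    ⟨1, UniversalEnvelopingAlgebra.ι R a, CharModule.gen χ, ?_⟩)
  rw [UniversalEnvelopingAlgebra.lift_ι_apply, UniversalEnvelopingAlgebra.lift_ι_apply, one_mul]
  rfl

theorem Ind.exists_smul_gen (v : Ind f (CharModule χ)) : ∃ u : U R L, v = u • Ind.gen f χ := by
  obtain ⟨t, rfl⟩ := Submodule.Quotient.mk_surjective _ v
  induction t using TensorProduct.induction_on with
  | zero => exact ⟨0, (zero_smul _ _).symm⟩
  | tmul u r =>
    refine ⟨(show R from r) • u, ?_⟩
    change _ = Submodule.Quotient.mk (((show R from r) • u) • ((1 : U R L) ⊗ₜ[R] CharModule.gen χ))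
    rw [TensorProduct.smul_tmul', smul_eq_mul, mul_one, TensorProduct.smul_tmul]
    congr 2
    exact (mul_one (show R from r)).symm
  | add s t hs ht =>
    obtain ⟨a, ha⟩ := hs
    obtain ⟨b, hb⟩ := ht
    exact ⟨a + b, by rw [Submodule.Quotient.mk_add, ha, hb, add_smul]; rfl⟩

/-- The universal property of the module induced from a character. -/
theorem Ind.exists_linearMap {V : Type*} [AddCommGroup V] [Module R V] [Module (U R L) V]
    [IsScalarTower R (U R L) V] (v : V)
    (hv : ∀ a, UniversalEnvelopingAlgebra.ι R (f a) • v = χ a • v) :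
    ∃ g : Ind f (CharModule χ) →ₗ[U R L] V, g (Ind.gen f χ) = v := by
  let b : U R L →ₗ[U R L] CharModule χ →ₗ[R] V :=
    LinearMap.toSpanSingleton (U R L) (CharModule χ →ₗ[R] V)
      (show R →ₗ[R] V from LinearMap.toSpanSingleton R V v)
  let g₀ : (U R L) ⊗[R] CharModule χ →ₗ[U R L] V := TensorProduct.AlgebraTensorModule.lift b
  have hg₀ : ∀ (u : U R L) (r : CharModule χ), g₀ (u ⊗ₜ[R] r) = u • (show R from r) • v := by
    intro u r
    rfl
  have hrel : indRelations f (CharModule χ) ≤ LinearMap.ker g₀ := by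
    refine Submodule.span_le.2 ?_
    rintro _ ⟨u, a, m, rfl⟩
    rw [SetLike.mem_coe, LinearMap.mem_ker, map_sub, sub_eq_zero, hg₀, hg₀, mul_smul]
    congr 1
    have ha : a ∈ Algebra.adjoin R (Set.range (UniversalEnvelopingAlgebra.ι R (L := H))) := by
      rw [adjoin_range_ι]; trivial
    induction ha using Algebra.adjoin_induction generalizing m with
    | mem _ h =>
      obtain ⟨x, rfl⟩ := h
      rw [UniversalEnvelopingAlgebra.lift_ι_apply, UniversalEnvelopingAlgebra.lift_ι_apply]
      change UniversalEnvelopingAlgebra.ι R (f x) • (show R from m) • v =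
        (χ x * (show R from m)) • v
      rw [smul_comm, hv, mul_comm, mul_smul]
    | algebraMap r =>
      rw [AlgHom.commutes, AlgHom.commutes, algebraMap_smul, smul_smul]
      rfl
    | add x y _ _ h₁ h₂ =>
      rw [map_add, map_add, add_smul, h₁, h₂, ← add_smul]
      rfl
    | mul x y _ _ h₁ h₂ =>
      rw [map_mul, map_mul, mul_smul, h₂, h₁]
      rfl
  refine ⟨(indRelations f (CharModule χ)).liftQ g₀ hrel, ?_⟩
  change g₀ ((1 : U R L) ⊗ₜ[R] CharModule.gen χ) = v
  rw [hg₀, one_smul]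
  exact one_smul R v

/-- By the universal property, `v` is the image of the generator under a module map. The polynomial
module will play the role of `S`. -/
theorem Ind.gen_ne_zero {S : Type*} [AddCommGroup S] [Module R S] (ρ : L →ₗ⁅R⁆ Module.End R S)
    {v : S} (hv : v ≠ 0) (hρ : ∀ a, ρ (f a) v = χ a • v) : Ind.gen f χ ≠ 0 := by
  let _ : Module (U R L) S := Module.compHom S (UniversalEnvelopingAlgebra.lift R ρ).toRingHom
  have hsmul : ∀ (u : U R L) (w : S), u • w = UniversalEnvelopingAlgebra.lift R ρ u w :=
    fun _ _ => rfl
  have : IsScalarTower R (U R L) S := ⟨fun r u w => by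
    rw [hsmul, hsmul, map_smul, LinearMap.smul_apply]⟩
  obtain ⟨g, hg⟩ := Ind.exists_linearMap (f := f) (χ := χ) v fun a => by
    rw [hsmul, UniversalEnvelopingAlgebra.lift_ι_apply, hρ]
  intro h0
  rw [h0, map_zero] at hg
  exact hv hg.symm

end Induced

/-! ### Ordered monomials. -/

section OrderedMonomial

variable {L I : Type*} [LieRing L] [LieAlgebra ℂ L] [LinearOrder I]

theorem orderedMonomial_zero (x : I → L) : orderedMonomial x 0 = 1 := by
  simp [orderedMonomial]

theorem orderedMonomial_eq_pow_mul_erase (x : I → L) {j : I} {s : I →₀ ℕ}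
    (hj : ∀ i ∈ s.support, j ≤ i) :
    orderedMonomial x s =
      UniversalEnvelopingAlgebra.ι ℂ (x j) ^ s j * orderedMonomial x (s.erase j) := by
  rcases eq_or_ne (s j) 0 with h0 | h0
  · rw [h0, pow_zero, one_mul, Finsupp.erase_of_notMem_support (Finsupp.notMem_support_iff.2 h0)]
  · have hs : s.support = insert j (s.erase j).support := by
      rw [Finsupp.support_erase, Finset.insert_erase (Finsupp.mem_support_iff.2 h0)]
    rw [orderedMonomial, hs, Finset.sort_insert (· ≤ ·), List.map_cons, List.prod_cons,
      orderedMonomial]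
    · congr 2
      refine List.map_congr_left fun i hi => ?_
      have : i ≠ j := by
        rintro rfl
        simp at hi
      rw [Finsupp.erase_ne this]
    · intro i hi
      rw [Finsupp.support_erase] at hi
      exact hj i (Finset.mem_of_mem_erase hi)
    · simp

theorem orderedMonomial_single_add (x : I → L) {j : I} {s : I →₀ ℕ}
    (hj : ∀ i ∈ s.support, j ≤ i) :
    orderedMonomial x (Finsupp.single j 1 + s) =
      UniversalEnvelopingAlgebra.ι ℂ (x j) * orderedMonomial x s := by
  have hj' : ∀ i ∈ (Finsupp.single j 1 + s).support, j ≤ i := by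
    intro i hi
    rcases Finset.mem_union.1 (Finsupp.support_add hi) with hi | hi
    · rw [Finset.mem_singleton.1 (Finsupp.support_single_subset hi)]
    · exact hj i hi
  rw [orderedMonomial_eq_pow_mul_erase x hj', orderedMonomial_eq_pow_mul_erase x hj,
    Finsupp.erase_add, Finsupp.erase_single, zero_add, Finsupp.add_apply, Finsupp.single_eq_same,
    pow_add, pow_one, mul_assoc]

end OrderedMonomial

/-! ### The Whittaker filtration and extraction of coefficients. -/

section Reduction

variable {L I : Type*} [LieRing L] [LieAlgebra ℂ L] {p : LieIdeal ℂ L}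
  (φ : LieAlgebra.LieCharacter ℂ p)

/-- The operator `q - φ(q)` on `W(φ)`. -/
def shift (q : p) : Module.End ℂ (W φ) :=
  LieModule.toEnd ℂ L (W φ) q - φ q • LinearMap.id

theorem shift_apply (q : p) (v : W φ) : shift φ q v = ⁅(q : L), v⁆ - φ q • v := rfl

/-- The vectors killed by all `n`-fold products of the operators `q - φ(q)`. -/
def whittakerFiltration : ℕ → Submodule ℂ (W φ)
  | 0 => ⊥
  | n + 1 => ⨅ q, (whittakerFiltration n).comap (shift φ q)

variable {φ}

theorem mem_whittakerFiltration_succ {n : ℕ} {v : W φ} :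
    v ∈ whittakerFiltration φ (n + 1) ↔ ∀ q, shift φ q v ∈ whittakerFiltration φ n := by
  simp [whittakerFiltration, Submodule.mem_iInf]

theorem whittakerFiltration_mono : Monotone (whittakerFiltration φ) := by
  refine monotone_nat_of_le_succ fun n => ?_
  induction n with
  | zero => exact bot_le
  | succ n ih =>
    intro v hv
    rw [mem_whittakerFiltration_succ] at *
    exact fun q => ih (hv q)

theorem mem_whittakerFiltration_one {v : W φ} :
    v ∈ whittakerFiltration φ 1 ↔ ∀ q : p, ⁅(q : L), v⁆ = φ q • v := by
  rw [mem_whittakerFiltration_succ]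
  refine forall_congr' fun q => ?_
  rw [shift_apply, whittakerFiltration, Submodule.mem_bot, sub_eq_zero]

/-- As `p` is an ideal, the commutator of `q` with `x` is again in `p`; it splits into the scalar `φ
⁅x, q⁆`, which carries the derivative, and a shift, which lowers the level. -/
theorem shift_lie (q : p) (x : L) (v : W φ) :
    shift φ q ⁅x, v⁆ = ⁅x, shift φ q v⁆ - (φ ⁅x, q⁆ • v + shift φ ⁅x, q⁆ v) := by
  have h : ((⁅x, q⁆ : p) : L) = ⁅x, (q : L)⁆ := rfl
  rw [shift_apply, shift_apply, shift_apply, h, lie_sub, lie_smul, lie_lie]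
  abel

theorem lie_mem_whittakerFiltration {n : ℕ} (x : L) {v : W φ} (hv : v ∈ whittakerFiltration φ n) :
    ⁅x, v⁆ ∈ whittakerFiltration φ (n + 1) := by
  induction n generalizing x v with
  | zero =>
    rw [whittakerFiltration, Submodule.mem_bot] at hv
    rw [hv, lie_zero]
    exact zero_mem _
  | succ n ih =>
    rw [mem_whittakerFiltration_succ]
    intro q
    rw [shift_lie]
    refine sub_mem (ih x (mem_whittakerFiltration_succ.1 hv q)) (add_mem ?_ ?_)
    · exact Submodule.smul_mem _ _ hv
    · exact whittakerFiltration_mono n.le_succ (mem_whittakerFiltration_succ.1 hv _)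

variable [LinearOrder I] (x : I → L)

theorem single_add_induction {P : (I →₀ ℕ) → Prop} (h0 : P 0)
    (h : ∀ j t, (∀ i ∈ t.support, j ≤ i) → P t → P (Finsupp.single j 1 + t)) (s : I →₀ ℕ) : P s := by
  induction hn : s.degree generalizing s with
  | zero => rwa [(Finsupp.degree_eq_zero_iff s).1 hn]
  | succ n ih =>
    obtain ⟨j, t, hj, rfl⟩ := exists_head s (by rintro rfl; simp at hn)
    rw [map_add, Finsupp.degree_single] at hn
    exact h j t hj (ih t (by omega))

theorem orderedMonomial_smul_mem_whittakerFiltration {v : W φ} (hv : v ∈ whittakerFiltration φ 1)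
    (s : I →₀ ℕ) : orderedMonomial x s • v ∈ whittakerFiltration φ (s.degree + 1) := by
  induction s using single_add_induction with
  | h0 => rw [orderedMonomial_zero, one_smul, map_zero]; exact hv
  | h j t hj ih =>
    rw [orderedMonomial_single_add x hj, mul_smul, map_add, Finsupp.degree_single, add_comm 1]
    exact lie_mem_whittakerFiltration _ ih

/-- If `φ([q, xⱼ]) = δᵢⱼ`, then `q - φ(q)` acts on ordered monomials as `∂/∂xᵢ`, up to terms of
lower degree. -/
theorem shift_orderedMonomial_smul {v : W φ} (hv : v ∈ whittakerFiltration φ 1) {i : I} {q : p}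
    (s : I →₀ ℕ) (hq : ∀ j ∈ s.support, φ ⁅x j, q⁆ = -(if j = i then 1 else 0)) :
    shift φ q (orderedMonomial x s • v)
      - (s i : ℂ) • orderedMonomial x (s - Finsupp.single i 1) • v
        ∈ whittakerFiltration φ (s.degree - 1) := by
  induction s using single_add_induction with
  | h0 =>
    rw [orderedMonomial_zero, one_smul, Finsupp.coe_zero, Pi.zero_apply, Nat.cast_zero, zero_smul,
      sub_zero]
    exact mem_whittakerFiltration_succ.1 hv q
  | h j t hj ih =>
    have hqt := hq j (by simp)
    specialize ih fun k hk => hq k (by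
      rw [Finsupp.mem_support_iff] at hk ⊢
      rw [Finsupp.add_apply]; omega)
    have hdeg : (Finsupp.single j 1 + t).degree - 1 = t.degree := by
      rw [map_add, Finsupp.degree_single]; omega
    have h₁ : ⁅x j, shift φ q (orderedMonomial x t • v)
        - (t i : ℂ) • orderedMonomial x (t - Finsupp.single i 1) • v⁆
          ∈ whittakerFiltration φ t.degree := by
      -- In degree zero `t.degree - 1` truncates to `0`, and raising the level would only give level
      -- one; but level zero is `⊥`, so the vector vanishes.
      rcases Nat.eq_zero_or_pos t.degree with h0 | h0
      · rw [h0, whittakerFiltration, Submodule.mem_bot] at ih ⊢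
        rw [ih, lie_zero]
      · have := lie_mem_whittakerFiltration (x j) ih
        rwa [Nat.sub_add_cancel h0] at this
    have h₂ : shift φ ⁅x j, q⁆ (orderedMonomial x t • v) ∈ whittakerFiltration φ t.degree :=
      mem_whittakerFiltration_succ.1 (orderedMonomial_smul_mem_whittakerFiltration x hv t) _
    -- The Leibniz rule for `∂/∂xᵢ` of `xⱼ x^t`. Where the exponent subtraction truncates, the
    -- coefficient `t i` is zero.
    have h₃ : (t i : ℂ) • ⁅x j, orderedMonomial x (t - Finsupp.single i 1) • v⁆
        + (if j = i then (1 : ℂ) else 0) • orderedMonomial x t • v =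
        ((Finsupp.single j 1 + t : I →₀ ℕ) i : ℂ) •
          orderedMonomial x (Finsupp.single j 1 + t - Finsupp.single i 1) • v := by
      have h₄ : ⁅x j, orderedMonomial x (t - Finsupp.single i 1) • v⁆ =
          orderedMonomial x (Finsupp.single j 1 + (t - Finsupp.single i 1)) • v := by
        rw [orderedMonomial_single_add x
          (fun k hk => hj k (Finsupp.support_mono tsub_le_self hk)), mul_smul]
        rfl
      have h₅ : t i ≠ 0 → Finsupp.single i 1 ≤ t := fun h => by
        rw [Finsupp.single_le_iff]; omega
      rw [h₄]
      rcases eq_or_ne j i with rfl | hji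
      · rw [if_pos rfl, add_tsub_cancel_left, Finsupp.add_apply, Finsupp.single_eq_same,
          Nat.cast_add, Nat.cast_one, add_comm (1 : ℂ), add_smul]
        congr 1
        rcases eq_or_ne (t j) 0 with h0 | h0
        · rw [h0, Nat.cast_zero, zero_smul, zero_smul]
        · rw [add_tsub_cancel_of_le (h₅ h0)]
      · rw [if_neg hji, zero_smul, add_zero, Finsupp.add_apply,
          Finsupp.single_eq_of_ne hji.symm, zero_add]
        rcases eq_or_ne (t i) 0 with h0 | h0
        · rw [h0, Nat.cast_zero, zero_smul, zero_smul]
        · rw [add_tsub_assoc_of_le (h₅ h0)]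
    have h₆ : orderedMonomial x (Finsupp.single j 1 + t) • v = ⁅x j, orderedMonomial x t • v⁆ := by
      rw [orderedMonomial_single_add x hj, mul_smul]
      rfl
    rw [hdeg, h₆, ← h₃, shift_lie, hqt]
    rw [lie_sub, lie_smul] at h₁
    convert sub_mem h₁ h₂ using 1
    rw [neg_smul]
    abel

variable {x}

/-- The functionals `q ↦ φ([xⱼ, q])` on `p` are linearly independent if the `xⱼ` are so modulo the
Whittaker annihilator. -/
theorem exists_dual (hx : LinearIndependent ℂ x)
    (hdis : Disjoint (Submodule.span ℂ (Set.range x)) (whittakerAnnihilator φ).toSubmodule)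
    (F : Finset I) (d : I → ℂ) : ∃ q : p, ∀ j ∈ F, φ ⁅x j, q⁆ = d j := by
  let g : p →ₗ[ℂ] (F → ℂ) := LinearMap.pi fun j =>
    (φ : p →ₗ[ℂ] ℂ) ∘ₗ LieModule.toEnd ℂ L p (x j)
  have hg : LinearMap.range g = ⊤ := by
    by_contra hne
    -- A functional `l` killing the range yields a combination of the `x j`, with coefficients the
    -- values of `l` on the standard basis, that lies in the annihilator; by hypothesis it is zero,
    -- so `l = 0`.
    obtain ⟨l, hl, hle⟩ := Submodule.exists_le_ker_of_lt_top _ (lt_top_iff_ne_top.2 hne)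
    have hsum : ∀ w : F → ℂ, l w = ∑ j, w j * l (Pi.single j 1) := by
      intro w
      conv_lhs => rw [LinearMap.pi_apply_eq_sum_univ l w]
      refine Finset.sum_congr rfl fun j _ => ?_
      rw [smul_eq_mul]
      congr 2
      ext k
      simp [Pi.single_apply, eq_comm]
    have hmem : ∑ j : F, l (Pi.single j 1) • x j ∈ (whittakerAnnihilator φ).toSubmodule := by
      intro q
      have : l (g q) = 0 := hle ⟨q, rfl⟩
      rw [hsum] at this
      have h₁ : ⁅∑ j : F, l (Pi.single j 1) • x j, q⁆
          = ∑ j : F, l (Pi.single j 1) • ⁅x j, q⁆ := by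
        let T := (LieModule.toEnd ℂ L p : L →ₗ[ℂ] Module.End ℂ p).flip q
        exact (map_sum T _ _).trans (Finset.sum_congr rfl fun j _ => map_smul T _ _)
      rw [h₁, ← this]
      change (φ : p →ₗ[ℂ] ℂ) _ = _
      rw [map_sum]
      refine Finset.sum_congr rfl fun j _ => ?_
      rw [map_smul, smul_eq_mul, mul_comm]
      rfl
    have h0 := Submodule.disjoint_def.1 hdis _ (Submodule.sum_mem _ fun (j : F) _ =>
      Submodule.smul_mem _ _ (Submodule.subset_span ⟨j, rfl⟩)) hmem
    have hli := Fintype.linearIndependent_iff.1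
      (hx.comp ((↑) : F → I) Subtype.val_injective) (fun j => l (Pi.single j 1)) h0
    apply hl
    refine LinearMap.ext fun w => ?_
    rw [hsum]
    simp [hli]
  obtain ⟨q, hq⟩ := LinearMap.range_eq_top.1 hg fun j => d j
  exact ⟨q, fun j hj => congrFun hq ⟨j, hj⟩⟩

/-- Induction on the degree by differentiation: an operator `q - φ(q)` with `q` dual to `x i`
preserves `N`, acts on the leading sum as `∂/∂xᵢ`, and pushes `r` and all error terms one level
down. The coefficient `f s` reappears multiplied by `s i`, invertible when `i` is in the support of
`s`. -/
theorem mem_of_sum_top_mem (hx : LinearIndependent ℂ x)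
    (hdis : Disjoint (Submodule.span ℂ (Set.range x)) (whittakerAnnihilator φ).toSubmodule)
    (N : LieSubmodule ℂ L (W φ)) (n : ℕ) (A : Finset (I →₀ ℕ)) (f : (I →₀ ℕ) → W φ)
    (hA : ∀ s ∈ A, s.degree = n) (hf : ∀ s ∈ A, f s ∈ whittakerFiltration φ 1) {r : W φ}
    (hr : r ∈ whittakerFiltration φ n) (hN : ∑ s ∈ A, orderedMonomial x s • f s + r ∈ N) :
    ∀ s ∈ A, f s ∈ N := by
  induction n generalizing A f r with
  | zero =>
    intro s hs
    rw [whittakerFiltration, Submodule.mem_bot] at hr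
    have h0 : ∀ t ∈ A, t = 0 := fun t ht => (Finsupp.degree_eq_zero_iff t).1 (hA t ht)
    have : A = {0} := by
      refine Finset.eq_singleton_iff_unique_mem.2 ⟨h0 s hs ▸ hs, h0⟩
    rw [this, Finset.sum_singleton, hr, add_zero, orderedMonomial_zero, one_smul] at hN
    rwa [h0 s hs]
  | succ n ih =>
    intro s hs
    have hs0 : s ≠ 0 := by
      rintro rfl
      have := hA 0 hs
      simp at this
    obtain ⟨i, hi⟩ := Finsupp.support_nonempty_iff.2 hs0
    obtain ⟨q, hq⟩ := exists_dual hx hdis (A.biUnion Finsupp.support)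
      fun j => -(if j = i then (1 : ℂ) else 0)
    have hle : ∀ t : I →₀ ℕ, t i ≠ 0 → Finsupp.single i 1 ≤ t := fun t h => by
      rw [Finsupp.single_le_iff]; omega
    -- `B` and `g` are the exponents and coefficients of the formal derivative along `i`; on
    -- exponents with `t i ≠ 0` lowering is injective, so no terms merge.
    let B := (A.filter fun t => t i ≠ 0).image fun t => t - Finsupp.single i 1
    let g : (I →₀ ℕ) → W φ := fun t => ((t i + 1 : ℕ) : ℂ) • f (t + Finsupp.single i 1)
    have hgs : ∀ t : I →₀ ℕ, t i ≠ 0 → g (t - Finsupp.single i 1) = (t i : ℂ) • f t := by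
      intro t ht
      simp only [g]
      rw [tsub_add_cancel_of_le (hle t ht), Finsupp.tsub_apply, Finsupp.single_eq_same,
        Nat.sub_add_cancel (Nat.one_le_iff_ne_zero.2 ht)]
    have hB : ∑ t ∈ B, orderedMonomial x t • g t =
        ∑ t ∈ A, (t i : ℂ) • orderedMonomial x (t - Finsupp.single i 1) • f t := by
      rw [Finset.sum_image]
      · rw [Finset.sum_filter]
        refine Finset.sum_congr rfl fun t _ => ?_
        split_ifs with h
        · rw [hgs t h, smul_comm]
        · rw [not_not.1 h, Nat.cast_zero, zero_smul]
      · intro t ht t' ht' h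
        simp only [Finset.coe_filter, Set.mem_ofPred_eq] at ht ht'
        dsimp only at h
        rw [← tsub_add_cancel_of_le (hle t ht.2), h, tsub_add_cancel_of_le (hle t' ht'.2)]
    have hmem : shift φ q (∑ s ∈ A, orderedMonomial x s • f s + r) ∈ N := by
      rw [shift_apply]
      exact sub_mem (N.lie_mem hN) (N.smul_mem _ hN)
    have key := ih B g ?_ ?_
      (r := shift φ q (∑ s ∈ A, orderedMonomial x s • f s + r)
        - ∑ t ∈ B, orderedMonomial x t • g t) ?_ (by rwa [add_sub_cancel])
      (s - Finsupp.single i 1)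
      (Finset.mem_image_of_mem _ (Finset.mem_filter.2 ⟨hs, Finsupp.mem_support_iff.1 hi⟩))
    · rw [hgs s (Finsupp.mem_support_iff.1 hi)] at key
      have := N.smul_mem ((s i : ℂ)⁻¹) key
      rwa [smul_smul, inv_mul_cancel₀, one_smul] at this
      exact_mod_cast Finsupp.mem_support_iff.1 hi
    · intro t ht
      obtain ⟨t, hmt, rfl⟩ := Finset.mem_image.1 ht
      replace ht := Finset.mem_filter.1 hmt
      have := hA t ht.1
      rw [← tsub_add_cancel_of_le (hle t ht.2), map_add, Finsupp.degree_single] at this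
      omega
    · intro t ht
      obtain ⟨t, hmt, rfl⟩ := Finset.mem_image.1 ht
      replace ht := Finset.mem_filter.1 hmt
      rw [hgs t ht.2]
      exact Submodule.smul_mem _ _ (hf t ht.1)
    · rw [hB, map_add, map_sum, add_sub_right_comm, ← Finset.sum_sub_distrib]
      refine add_mem (Submodule.sum_mem _ fun t ht => ?_) (mem_whittakerFiltration_succ.1 hr q)
      have := shift_orderedMonomial_smul x (hf t ht) (i := i) (q := q) t fun j hj =>
        hq j (Finset.mem_biUnion.2 ⟨t, ht, hj⟩)
      rwa [hA t ht] at this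

/-- Terms of degree below `n` lie in level `n`, so they serve as the remainder while the top
coefficients are extracted; the top terms then lie in `N` and can be subtracted. -/
theorem mem_of_sum_mem (hx : LinearIndependent ℂ x)
    (hdis : Disjoint (Submodule.span ℂ (Set.range x)) (whittakerAnnihilator φ).toSubmodule)
    (N : LieSubmodule ℂ L (W φ)) (A : Finset (I →₀ ℕ)) (f : (I →₀ ℕ) → W φ)
    (hf : ∀ s ∈ A, f s ∈ whittakerFiltration φ 1)
    (hN : ∑ s ∈ A, orderedMonomial x s • f s ∈ N) : ∀ s ∈ A, f s ∈ N := by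
  suffices ∀ n, ∀ A : Finset (I →₀ ℕ), (∀ s ∈ A, s.degree < n) →
      (∀ s ∈ A, f s ∈ whittakerFiltration φ 1) → ∑ s ∈ A, orderedMonomial x s • f s ∈ N →
      ∀ s ∈ A, f s ∈ N from
    this (A.sup Finsupp.degree + 1) A (fun s hs => Nat.lt_succ_of_le (Finset.le_sup hs)) hf hN
  intro n
  induction n with
  | zero => exact fun A hA _ _ s hs => absurd (hA s hs) (Nat.not_lt_zero _)
  | succ n ih =>
    intro A hA hf hN
    have htop : ∀ s ∈ A.filter (fun s => s.degree = n), f s ∈ N := by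
      refine mem_of_sum_top_mem hx hdis N n _ f (fun s hs => (Finset.mem_filter.1 hs).2)
        (fun s hs => hf s (Finset.mem_filter.1 hs).1)
        (r := ∑ s ∈ A.filter (fun s => ¬ s.degree = n), orderedMonomial x s • f s) ?_ ?_
      · refine Submodule.sum_mem _ fun s hs => ?_
        rw [Finset.mem_filter] at hs
        have := hA s hs.1
        exact whittakerFiltration_mono (by omega)
          (orderedMonomial_smul_mem_whittakerFiltration x (hf s hs.1) s)
      · rwa [Finset.sum_filter_add_sum_filter_not]
    have hlow : ∀ s ∈ A.filter (fun s => ¬ s.degree = n), f s ∈ N := by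
      refine ih _ (fun s hs => ?_) (fun s hs => hf s (Finset.mem_filter.1 hs).1) ?_
      · rw [Finset.mem_filter] at hs
        have := hA s hs.1
        omega
      · rw [← Finset.sum_filter_add_sum_filter_not A (fun s => s.degree = n)] at hN
        refine (add_mem_cancel_left ?_).1 hN
        exact sum_mem fun s hs => Ind.smul_mem N _ (htop s hs)
    intro s hs
    by_cases h : s.degree = n
    · exact htop s (Finset.mem_filter.2 ⟨hs, h⟩)
    · exact hlow s (Finset.mem_filter.2 ⟨hs, h⟩)

/-- A submodule of `W(φ)` contains with a combination of ordered monomials, with coefficients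
in a space of Whittaker vectors, all its coefficients. -/
theorem mem_span_inter (hx : LinearIndependent ℂ x)
    (hdis : Disjoint (Submodule.span ℂ (Set.range x)) (whittakerAnnihilator φ).toSubmodule)
    (N : LieSubmodule ℂ L (W φ)) (E : Submodule ℂ (W φ)) (hE : E ≤ whittakerFiltration φ 1)
    {v : W φ} (hvN : v ∈ N)
    (hv : v ∈ Submodule.span ℂ {v | ∃ s : I →₀ ℕ, ∃ e ∈ E, v = orderedMonomial x s • e}) :
    v ∈ Submodule.span ℂ
      {v | ∃ s : I →₀ ℕ, ∃ e ∈ E, e ∈ N ∧ v = orderedMonomial x s • e} := by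
  have : ∃ g : (I →₀ ℕ) →₀ E, v = g.sum fun s e => orderedMonomial x s • (e : W φ) := by
    clear hvN
    induction hv using Submodule.span_induction with
    | mem v h =>
      obtain ⟨s, e, he, rfl⟩ := h
      exact ⟨Finsupp.single s ⟨e, he⟩, by rw [Finsupp.sum_single_index (by simp)]⟩
    | zero => exact ⟨0, by simp⟩
    | add v w _ _ hv hw =>
      obtain ⟨g, rfl⟩ := hv
      obtain ⟨g', rfl⟩ := hw
      exact ⟨g + g', by rw [Finsupp.sum_add_index'] <;> simp [smul_add]⟩
    | smul r v _ hv =>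
      obtain ⟨g, rfl⟩ := hv
      refine ⟨r • g, ?_⟩
      rw [Finsupp.sum_smul_index' (by simp), Finsupp.smul_sum]
      exact Finsupp.sum_congr fun s _ => smul_comm _ _ _
  obtain ⟨g, rfl⟩ := this
  have hg := mem_of_sum_mem hx hdis N g.support (fun s => (g s : W φ))
    (fun s _ => hE (g s).2) hvN
  exact Submodule.sum_mem _ fun s hs =>
    Submodule.subset_span ⟨s, g s, (g s).2, hg s hs, rfl⟩

end Reduction

/-! ### Adapted data from a complement, and nonvanishing of induced modules. -/

section Complement

variable {L I : Type*} [LieRing L] [LieAlgebra ℂ L] {x : I → L}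

/-- A basis of a complement of a subalgebra `H` and a character of `H` give adapted data. -/
theorem exists_isAdapted (hx : LinearIndependent ℂ x) (H : Submodule ℂ L)
    (hc : IsCompl (Submodule.span ℂ (Set.range x)) H) (hH : ∀ a ∈ H, ∀ b ∈ H, ⁅a, b⁆ ∈ H)
    (χ₀ : H →ₗ[ℂ] ℂ) (hχ₀ : ∀ a b : H, χ₀ ⟨⁅(a : L), (b : L)⁆, hH a a.2 b b.2⟩ = 0) :
    ∃ (c : L →ₗ[ℂ] I →₀ ℂ) (χ : L →ₗ[ℂ] ℂ), IsAdapted x c χ ∧ (∀ a, c a = 0 ↔ a ∈ H) ∧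
      ∀ a : H, χ a = χ₀ a := by
  let B := Module.Basis.span hx
  let c : L →ₗ[ℂ] I →₀ ℂ := B.repr.toLinearMap ∘ₗ Submodule.projectionOnto _ H hc
  let χ : L →ₗ[ℂ] ℂ := χ₀ ∘ₗ Submodule.projectionOnto H _ hc.symm
  have hcH : ∀ a, c a = 0 ↔ a ∈ H := fun a => by
    change B.repr _ = 0 ↔ _
    rw [LinearEquiv.map_eq_zero_iff, Submodule.projectionOnto_apply_eq_zero_iff]
  have hχH : ∀ a : H, χ a = χ₀ a := fun a => by
    change χ₀ _ = _
    rw [Submodule.projectionOnto_apply_left]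
  have hmem : ∀ i, x i ∈ Submodule.span ℂ (Set.range x) := fun i => Submodule.subset_span ⟨i, rfl⟩
  refine ⟨c, χ, ⟨fun i => ?_, fun a b ha hb => ?_, fun i => ?_, fun a b ha hb => ?_⟩, hcH, hχH⟩
  · change B.repr _ = _
    rw [Submodule.projectionOnto_apply_of_mem_left hc (hmem i)]
    have : (⟨x i, hmem i⟩ : Submodule.span ℂ (Set.range x)) = B i :=
      (Module.Basis.span_apply hx i).symm
    rw [this, Module.Basis.repr_self]
  · rw [hcH] at *
    exact hH a ha b hb
  · change χ₀ _ = 0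
    rw [(Submodule.projectionOnto_apply_eq_zero_iff hc.symm).2 (hmem i), map_zero]
  · rw [hcH] at *
    exact (hχH ⟨_, hH a ha b hb⟩).trans (hχ₀ ⟨a, ha⟩ ⟨b, hb⟩)

/-- The module induced from a character of a subalgebra is nonzero. -/
theorem Ind.gen_ne_zero_of_isCompl [LinearOrder I] {K : Type*} [LieRing K] [LieAlgebra ℂ K]
    {f : K →ₗ⁅ℂ⁆ L} (hf : Function.Injective f) {χ : LieAlgebra.LieCharacter ℂ K}
    (hx : LinearIndependent ℂ x)
    (hc : IsCompl (Submodule.span ℂ (Set.range x)) (LinearMap.range (f : K →ₗ[ℂ] L))) :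
    Ind.gen f χ ≠ 0 := by
  let e : K ≃ₗ[ℂ] LinearMap.range (f : K →ₗ[ℂ] L) := LinearEquiv.ofInjective (f : K →ₗ[ℂ] L) hf
  have he : ∀ a h, e.symm ⟨f a, h⟩ = a := fun a h => by
    rw [LinearEquiv.symm_apply_eq]
    rfl
  have hH : ∀ a ∈ LinearMap.range (f : K →ₗ[ℂ] L), ∀ b ∈ LinearMap.range (f : K →ₗ[ℂ] L),
      ⁅a, b⁆ ∈ LinearMap.range (f : K →ₗ[ℂ] L) := by
    rintro _ ⟨a, rfl⟩ _ ⟨b, rfl⟩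
    exact ⟨⁅a, b⁆, LieHom.map_lie f a b⟩
  obtain ⟨c, χ', had, hcH, hχ'⟩ := exists_isAdapted hx _ hc hH
    ((χ : K →ₗ[ℂ] ℂ) ∘ₗ e.symm.toLinearMap) (by
      rintro ⟨_, a, rfl⟩ ⟨_, b, rfl⟩
      change χ (e.symm _) = 0
      have : ∀ h, e.symm ⟨⁅f a, f b⁆, h⟩ = ⁅a, b⁆ := by
        rw [← LieHom.map_lie]
        exact he _
      exact (congrArg χ (this _)).trans (LieAlgebra.lieCharacter_apply_lie χ a b))
  -- The constant polynomial `1` is a nonzero vector on which the subalgebra acts through its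
  -- character.
  refine Ind.gen_ne_zero had.rep (v := 1) one_ne_zero fun a => ?_
  have h₁ : c (f a) = 0 := (hcH _).2 ⟨a, rfl⟩
  have h₂ : χ' (f a) = χ a :=
    (hχ' ⟨f a, a, rfl⟩).trans (congrArg χ (he a _))
  rw [← h₂]
  exact had.act_of_coord_eq_zero h₁

end Complement

/-! ### Spanning by ordered monomials, and irreducibility. -/

section Spanning

variable {L I : Type*} [LieRing L] [LieAlgebra ℂ L] {p : LieIdeal ℂ L}
  {φ : LieAlgebra.LieCharacter ℂ p} [LinearOrder I] {x : I → L}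

/-- Ordered monomials in a basis of a complement of `p`, applied to a Whittaker vector, span a
submodule of `W(φ)`. -/
theorem lie_mem_span_range (hx : LinearIndependent ℂ x)
    (hc : IsCompl (Submodule.span ℂ (Set.range x)) p.toSubmodule) {m : (I →₀ ℕ) → W φ}
    (h0 : m 0 ∈ whittakerFiltration φ 1)
    (hm : ∀ j s, (∀ i ∈ s.support, j ≤ i) → m (Finsupp.single j 1 + s) = ⁅x j, m s⁆)
    (a : L) {v : W φ} (hv : v ∈ Submodule.span ℂ (Set.range m)) :
    ⁅a, v⁆ ∈ Submodule.span ℂ (Set.range m) := by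
  obtain ⟨c, χ, had, hcH, hχ⟩ := exists_isAdapted hx _ hc
    (fun a _ b hb => lie_mem_right ℂ L p a b hb) (φ : p →ₗ[ℂ] ℂ)
    (fun a b => LieAlgebra.lieCharacter_apply_lie φ a b)
  -- The span is the image of the polynomial module under `θ`; it is stable because `θ` intertwines
  -- the two actions.
  let θ : MvPolynomial I ℂ →ₗ[ℂ] W φ := (MvPolynomial.basisMonomials I ℂ).constr ℂ m
  have hθ : ∀ s, θ (MvPolynomial.monomial s 1) = m s := fun s => by
    have := (MvPolynomial.basisMonomials I ℂ).constr_basis ℂ m s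
    rwa [MvPolynomial.coe_basisMonomials] at this
  have hθ1 : θ 1 = m 0 := hθ 0
  have hrange : LinearMap.range θ = Submodule.span ℂ (Set.range m) :=
    (MvPolynomial.basisMonomials I ℂ).constr_range ℂ
  rw [← hrange] at hv ⊢
  obtain ⟨P, rfl⟩ := hv
  refine ⟨act x c χ a P, had.map_act (LieModule.toEnd ℂ L (W φ)) θ (fun b hb => ?_)
    (fun j s hj => ?_) a P⟩
  · rw [hθ1]
    have hb' : b ∈ p := (hcH b).1 hb
    have := mem_whittakerFiltration_one.1 h0 ⟨b, hb'⟩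
    have h₂ : χ b = φ ⟨b, hb'⟩ := hχ ⟨b, hb'⟩
    rw [h₂]
    exact this
  · rw [X_mul_monomial, hθ, hθ, hm j s hj]
    rfl

theorem smul_mem_span_range (hx : LinearIndependent ℂ x)
    (hc : IsCompl (Submodule.span ℂ (Set.range x)) p.toSubmodule) {m : (I →₀ ℕ) → W φ}
    (h0 : m 0 ∈ whittakerFiltration φ 1)
    (hm : ∀ j s, (∀ i ∈ s.support, j ≤ i) → m (Finsupp.single j 1 + s) = ⁅x j, m s⁆)
    (u : UniversalEnvelopingAlgebra ℂ L) :
    u • m 0 ∈ Submodule.span ℂ (Set.range m) :=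
  smul_mem_of_forall_ι _ (fun a _ hv => lie_mem_span_range hx hc h0 hm a hv) u
    (Submodule.subset_span ⟨0, rfl⟩)

theorem orderedMonomial_single_add_smul {j : I} {s : I →₀ ℕ} (hj : ∀ i ∈ s.support, j ≤ i)
    (v : W φ) :
    orderedMonomial x (Finsupp.single j 1 + s) • v = ⁅x j, orderedMonomial x s • v⁆ := by
  rw [orderedMonomial_single_add x hj, mul_smul, Ind.ι_smul]

theorem wVec_mem_whittakerFiltration : wVec φ ∈ whittakerFiltration φ 1 :=
  mem_whittakerFiltration_one.2 fun q => Ind.ι_smul_gen (f := LieIdeal.incl p) (χ := φ) q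

theorem eq_top_of_wVec_mem {N : LieSubmodule ℂ L (W φ)} (h : wVec φ ∈ N) : N = ⊤ := by
  rw [eq_top_iff]
  intro v _
  obtain ⟨u, rfl⟩ := Ind.exists_smul_gen v
  exact Ind.smul_mem N u h

open scoped Classical in
/-- `W(φ)` is irreducible if `p` is its own Whittaker annihilator. -/
theorem isIrreducible_W (hp : (whittakerAnnihilator φ).toSubmodule ≤ p.toSubmodule) :
    LieModule.IsIrreducible ℂ L (W φ) := by
  obtain ⟨Q, hQ⟩ := Submodule.exists_isCompl p.toSubmodule
  let B := Module.Basis.ofVectorSpace ℂ Q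
  let _ : LinearOrder (Module.Basis.ofVectorSpaceIndex ℂ Q) := linearOrderOfSTO WellOrderingRel
  let x : Module.Basis.ofVectorSpaceIndex ℂ Q → L := fun i => B i
  have hx : LinearIndependent ℂ x := B.linearIndependent.map' Q.subtype Q.ker_subtype
  have hspan : Submodule.span ℂ (Set.range x) = Q := by
    have : Set.range x = Q.subtype '' Set.range B := by
      rw [← Set.range_comp]
      rfl
    rw [this, Submodule.span_image, B.span_eq, Submodule.map_top, Submodule.range_subtype]
  have hc : IsCompl (Submodule.span ℂ (Set.range x)) p.toSubmodule := by
    rw [hspan]; exact hQ.symm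
  have hrange : LinearMap.range ((LieIdeal.incl p : p →ₗ⁅ℂ⁆ L) : p →ₗ[ℂ] L) = p.toSubmodule :=
    Submodule.range_subtype _
  have hw : wVec φ ≠ 0 := Ind.gen_ne_zero_of_isCompl (f := LieIdeal.incl p)
    Subtype.val_injective hx (hrange ▸ hc)
  have : Nontrivial (W φ) := ⟨_, _, hw⟩
  refine LieModule.IsIrreducible.mk fun N hN => ?_
  by_contra hne
  refine hN ((LieSubmodule.eq_bot_iff N).2 fun v hv => ?_)
  have hspanv := smul_mem_span_range hx hc (φ := φ)
    (m := fun s => orderedMonomial x s • wVec φ)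
    (by rw [orderedMonomial_zero, one_smul]; exact wVec_mem_whittakerFiltration)
    (fun j s hj => orderedMonomial_single_add_smul hj _)
  have hE : Submodule.span ℂ {wVec φ} ≤ whittakerFiltration φ 1 := by
    rw [Submodule.span_singleton_le_iff_mem]
    exact wVec_mem_whittakerFiltration
  -- The coefficient space is the line through `w_φ`; since `N` is proper, it meets this line only
  -- in zero.
  have hmem := mem_span_inter hx (hc.disjoint.mono_right hp) N _ hE hv (by
    obtain ⟨u, rfl⟩ := Ind.exists_smul_gen v
    specialize hspanv u
    rw [orderedMonomial_zero, one_smul] at hspanv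
    refine Submodule.span_mono ?_ hspanv
    rintro _ ⟨s, rfl⟩
    exact ⟨s, wVec φ, Submodule.mem_span_singleton_self _, rfl⟩)
  have hzero : ∀ e ∈ Submodule.span ℂ {wVec φ}, e ∈ N → e = 0 := by
    intro e he heN
    obtain ⟨r, rfl⟩ := Submodule.mem_span_singleton.1 he
    by_cases hr : r = 0
    · rw [hr, zero_smul]
    · refine absurd (eq_top_of_wVec_mem ?_) hne
      have := N.smul_mem r⁻¹ heN
      rwa [smul_smul, inv_mul_cancel₀ hr, one_smul] at this
  rw [← Submodule.mem_bot ℂ]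
  refine (Submodule.span_le (p := ⊥)).2 ?_ hmem
  rintro _ ⟨s, e, he, heN, rfl⟩
  rw [hzero e he heN, smul_zero]
  exact zero_mem _

end Spanning

/-! ### Maximal submodules in the one-dimensional case. -/

section MaximalSubmodules

open Polynomial

variable {L I : Type*} [LieRing L] [LieAlgebra ℂ L] {p : LieIdeal ℂ L}
  {φ : LieAlgebra.LieCharacter ℂ p}

/-- The commutator of `q - φ(q)` with `a` acts on a Whittaker vector by the scalar `-φ ⁅a, q⁆`,
which is zero. -/
theorem lie_mem_whittakerFiltration_one {a : L} (ha : a ∈ whittakerAnnihilator φ) {v : W φ}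
    (hv : v ∈ whittakerFiltration φ 1) : ⁅a, v⁆ ∈ whittakerFiltration φ 1 := by
  have h : ∀ q, shift φ q v = 0 := mem_whittakerFiltration_succ.1 hv
  refine mem_whittakerFiltration_succ.2 fun q => ?_
  rw [shift_lie, h, h, ha q, lie_zero, zero_smul, add_zero, sub_zero]
  exact zero_mem _

/-- The map `f ↦ f(y) w_φ`. -/
def evalWVec (φ : LieAlgebra.LieCharacter ℂ p) (y : L) : ℂ[X] →ₗ[ℂ] W φ where
  toFun f := aeval (UniversalEnvelopingAlgebra.ι ℂ y) f • wVec φ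
  map_add' f g := by rw [map_add, add_smul]
  map_smul' r f := by rw [map_smul, smul_assoc, RingHom.id_apply]

theorem evalWVec_apply (y : L) (f : ℂ[X]) :
    evalWVec φ y f = aeval (UniversalEnvelopingAlgebra.ι ℂ y) f • wVec φ := rfl

theorem evalWVec_mul (y : L) (f g : ℂ[X]) :
    evalWVec φ y (f * g) = aeval (UniversalEnvelopingAlgebra.ι ℂ y) f • evalWVec φ y g := by
  rw [evalWVec_apply, map_mul, mul_smul, evalWVec_apply]

theorem evalWVec_X_sub_C (y : L) (ξ : ℂ) :
    evalWVec φ y (X - C ξ) = (UniversalEnvelopingAlgebra.ι ℂ y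
      - algebraMap ℂ (UniversalEnvelopingAlgebra ℂ L) ξ) • wVec φ := by
  rw [evalWVec_apply, map_sub, aeval_X, aeval_C]

theorem range_evalWVec_le {y : L} (hy : y ∈ whittakerAnnihilator φ) :
    LinearMap.range (evalWVec φ y) ≤ whittakerFiltration φ 1 := by
  rintro _ ⟨f, rfl⟩
  induction f using Polynomial.induction_on' with
  | add f g hf hg => rw [map_add]; exact add_mem hf hg
  | monomial n r =>
    rw [← C_mul_X_pow_eq_monomial, ← smul_eq_C_mul, map_smul]
    refine Submodule.smul_mem _ _ ?_
    induction n with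
    | zero =>
      rw [evalWVec_apply, pow_zero, map_one, one_smul]
      exact wVec_mem_whittakerFiltration
    | succ n ih =>
      rw [pow_succ', evalWVec_mul, aeval_X]
      exact lie_mem_whittakerFiltration_one hy ih

/-- The family `x` followed by `y`. -/
def withLast (x : I → L) (y : L) : WithTop I → L := WithTop.recTopCoe y x

theorem range_withLast (x : I → L) (y : L) :
    Submodule.span ℂ (Set.range (withLast x y)) =
      Submodule.span ℂ (Set.range x) ⊔ Submodule.span ℂ {y} := by
  rw [← Submodule.span_union]
  congr 1
  ext z
  constructor
  · rintro ⟨i, rfl⟩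
    induction i using WithTop.recTopCoe with
    | top => exact Or.inr rfl
    | coe i => exact Or.inl ⟨i, rfl⟩
  · rintro (⟨i, rfl⟩ | h)
    · exact ⟨(i : WithTop I), rfl⟩
    · exact ⟨⊤, h.symm⟩

/-- The families `x` and `y` together form a basis of a complement of `p`. -/
theorem withLast_basis {x : I → L} {y : L} (hx : LinearIndependent ℂ x) (hy : y ∉ p)
    (hyG : Submodule.span ℂ {y} ⊔ p.toSubmodule = (whittakerAnnihilator φ).toSubmodule)
    (hdis : Disjoint (Submodule.span ℂ {y}) p.toSubmodule)
    (hc : IsCompl (Submodule.span ℂ (Set.range x)) (whittakerAnnihilator φ).toSubmodule) :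
    LinearIndependent ℂ (withLast x y) ∧
      IsCompl (Submodule.span ℂ (Set.range (withLast x y))) p.toSubmodule := by
  constructor
  · refine linearIndependent_option.2 ⟨hx, fun h => hy ?_⟩
    have h₁ : y ∈ (whittakerAnnihilator φ).toSubmodule := by
      rw [← hyG]
      exact Submodule.mem_sup_left (Submodule.mem_span_singleton_self y)
    have h₂ : y = 0 := Submodule.disjoint_def.1 hc.disjoint y h h₁
    rw [h₂]
    exact zero_mem p
  · rw [range_withLast]
    rw [← hyG] at hc
    exact hdis.isCompl_sup_left_of_isCompl_sup_right hc

/-- There is an extension of `φ` to the Whittaker annihilator with a given value at `y`. -/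
theorem exists_isExtension {x : I → L} {y : L} (hx : LinearIndependent ℂ (withLast x y))
    (hc : IsCompl (Submodule.span ℂ (Set.range (withLast x y))) p.toSubmodule)
    (hy : y ∈ whittakerAnnihilator φ)
    (hyG : Submodule.span ℂ {y} ⊔ p.toSubmodule = (whittakerAnnihilator φ).toSubmodule) (ξ : ℂ) :
    ∃ φ' : LieAlgebra.LieCharacter ℂ (whittakerAnnihilator φ),
      IsExtension φ φ' ∧ φ' ⟨y, hy⟩ = ξ := by
  obtain ⟨c, χ, had, hcH, hχ⟩ := exists_isAdapted hx _ hc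
    (fun a _ b hb => lie_mem_right ℂ L p a b hb) (φ : p →ₗ[ℂ] ℂ)
    (fun a b => LieAlgebra.lieCharacter_apply_lie φ a b)
  -- Extend `φ` by zero along the complement, then add `ξ` times the coordinate along `y`, whose
  -- index is `⊤`.
  let ψ : L →ₗ[ℂ] ℂ := χ + ξ • Finsupp.lapply (R := ℂ) (⊤ : WithTop I) ∘ₗ c
  have hψ : ∀ a : p, ψ a = φ a := fun a => by
    have h₁ : c a = 0 := (hcH a).2 a.2
    have h₂ : ψ a = χ a + ξ * c a ⊤ := rfl
    rw [h₂, h₁, Finsupp.coe_zero, Pi.zero_apply, mul_zero, add_zero]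
    exact hχ a
  have hψy : ψ y = ξ := by
    have h₂ : ψ y = χ (withLast x y ⊤) + ξ * c (withLast x y ⊤) ⊤ := rfl
    rw [h₂, had.char_apply, had.coord_apply, Finsupp.single_eq_same, mul_one, zero_add]
  have hlie : ∀ a ∈ whittakerAnnihilator φ, ∀ b ∈ whittakerAnnihilator φ, ψ ⁅a, b⁆ = 0 := by
    have hp : ∀ a ∈ whittakerAnnihilator φ, ∀ q : p, ψ ⁅a, (q : L)⁆ = 0 := fun a ha q =>
      (hψ ⁅a, q⁆).trans (ha q)
    have hp' : ∀ a ∈ whittakerAnnihilator φ, ∀ q : p, ψ ⁅(q : L), a⁆ = 0 := fun a ha q => by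
      rw [← lie_skew, map_neg, hp a ha q, neg_zero]
    intro a ha b hb
    have ha' : a ∈ (whittakerAnnihilator φ).toSubmodule := ha
    have hb' : b ∈ (whittakerAnnihilator φ).toSubmodule := hb
    rw [← hyG] at ha' hb'
    obtain ⟨_, h₁, q, hq, rfl⟩ := Submodule.mem_sup.1 ha'
    obtain ⟨_, h₂, r, hr, rfl⟩ := Submodule.mem_sup.1 hb'
    obtain ⟨s, rfl⟩ := Submodule.mem_span_singleton.1 h₁
    obtain ⟨t, rfl⟩ := Submodule.mem_span_singleton.1 h₂
    rw [add_lie, map_add, hp' _ hb ⟨q, hq⟩, lie_add, map_add, smul_lie, smul_lie, map_smul,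
      map_smul, hp _ hy ⟨r, hr⟩, lie_smul, lie_self]
    simp
  let φ' : LieAlgebra.LieCharacter ℂ (whittakerAnnihilator φ) :=
    { ψ ∘ₗ (whittakerAnnihilator φ).toSubmodule.subtype with
      map_lie' := fun {a b} => by
        rw [LieRing.of_associative_ring_bracket, mul_comm, sub_self]
        exact hlie a a.2 b b.2 }
  exact ⟨φ', hψ, hψy⟩

variable [LinearOrder I] {x : I → L}

/-- The vector `x^α y^n v`, where `(α, n) = s`. -/
def lastMonomial (x : I → L) (y : L) (v : W φ) (s : WithTop I →₀ ℕ) : W φ :=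
  orderedMonomial x (s.comapDomain WithTop.some WithTop.coe_injective.injOn) •
    UniversalEnvelopingAlgebra.ι ℂ y ^ s ⊤ • v

theorem lastMonomial_zero (y : L) (v : W φ) : lastMonomial x y v 0 = v := by
  rw [lastMonomial, Finsupp.comapDomain_zero, orderedMonomial_zero, one_smul, Finsupp.coe_zero,
    Pi.zero_apply, pow_zero, one_smul]

theorem lastMonomial_single_add (y : L) (v : W φ) (j : WithTop I) (s : WithTop I →₀ ℕ)
    (hj : ∀ i ∈ s.support, j ≤ i) :
    lastMonomial x y v (Finsupp.single j 1 + s) = ⁅withLast x y j, lastMonomial x y v s⁆ := by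
  rw [lastMonomial, lastMonomial, Finsupp.comapDomain_add_of_injective WithTop.coe_injective,
    Finsupp.add_apply]
  induction j using WithTop.recTopCoe with
  | top =>
    have h₁ : s.comapDomain WithTop.some WithTop.coe_injective.injOn = 0 := by
      ext i
      rw [Finsupp.comapDomain_apply, Finsupp.coe_zero, Pi.zero_apply]
      by_contra h
      exact WithTop.coe_ne_top (top_le_iff.1 (hj _ (Finsupp.mem_support_iff.2 h)))
    have h₂ : (Finsupp.single (⊤ : WithTop I) 1).comapDomain WithTop.some
        WithTop.coe_injective.injOn = 0 := by
      ext i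
      rw [Finsupp.comapDomain_apply, Finsupp.single_eq_of_ne WithTop.coe_ne_top]
      rfl
    rw [h₁, h₂, zero_add, orderedMonomial_zero, one_smul, one_smul, Finsupp.single_eq_same,
      pow_add, pow_one, mul_smul]
    rfl
  | coe j =>
    rw [Finsupp.comapDomain_single, Finsupp.single_eq_of_ne WithTop.top_ne_coe, zero_add,
      orderedMonomial_single_add_smul]
    · rfl
    · intro i hi
      rw [Finsupp.mem_support_iff, Finsupp.comapDomain_apply] at hi
      exact WithTop.coe_le_coe.1 (hj _ (Finsupp.mem_support_iff.2 hi))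

/-- Encoding `(α, n)` as one exponent on `WithTop I`, with `y` last, makes the spanning result for a
complement of `p` applicable to `J`. -/
theorem J_eq_span_lastMonomial (y : L) (ξ : ℂ) :
    J φ x y ξ = Submodule.span ℂ (Set.range (lastMonomial x y (evalWVec φ y (X - C ξ)))) := by
  rw [J]
  congr 1
  ext v
  rw [evalWVec_X_sub_C]
  constructor
  · rintro ⟨α, n, rfl⟩
    refine ⟨α.mapDomain WithTop.some + Finsupp.single ⊤ n, ?_⟩
    rw [lastMonomial, mul_smul, mul_smul]
    congr 2
    · ext i
      rw [Finsupp.comapDomain_apply, Finsupp.add_apply,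
        Finsupp.mapDomain_apply WithTop.coe_injective,
        Finsupp.single_eq_of_ne WithTop.coe_ne_top, add_zero]
    · rw [Finsupp.add_apply, Finsupp.single_eq_same, Finsupp.mapDomain_of_notMem_range, zero_add]
      rintro ⟨i, hi⟩
      exact WithTop.coe_ne_top hi
  · rintro ⟨s, rfl⟩
    exact ⟨_, _, by rw [lastMonomial, mul_smul, mul_smul]⟩

/-- The submodule `J_ξ`. -/
def JSubmodule {y : L} (hx : LinearIndependent ℂ (withLast x y))
    (hc : IsCompl (Submodule.span ℂ (Set.range (withLast x y))) p.toSubmodule)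
    (hy : y ∈ whittakerAnnihilator φ) (ξ : ℂ) : LieSubmodule ℂ L (W φ) where
  __ := J φ x y ξ
  lie_mem {a v} hv := by
    change v ∈ J φ x y ξ at hv
    change ⁅a, v⁆ ∈ J φ x y ξ
    rw [J_eq_span_lastMonomial] at *
    refine lie_mem_span_range hx hc ?_ (lastMonomial_single_add y _) a hv
    rw [lastMonomial_zero]
    exact range_evalWVec_le hy ⟨_, rfl⟩

section

variable {y : L} (hx : LinearIndependent ℂ (withLast x y))
    (hc : IsCompl (Submodule.span ℂ (Set.range (withLast x y))) p.toSubmodule)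
    (hy : y ∈ whittakerAnnihilator φ)

theorem evalWVec_mem_JSubmodule (ξ : ℂ) : evalWVec φ y (X - C ξ) ∈ JSubmodule hx hc hy ξ := by
  change _ ∈ J φ x y ξ
  rw [J_eq_span_lastMonomial]
  exact Submodule.subset_span ⟨0, lastMonomial_zero _ _⟩

theorem JSubmodule_le {ξ : ℂ} {N : LieSubmodule ℂ L (W φ)} (hN : evalWVec φ y (X - C ξ) ∈ N) :
    JSubmodule hx hc hy ξ ≤ N := by
  intro v hv
  change v ∈ J φ x y ξ at hv
  refine (Submodule.span_le (p := N.toSubmodule)).2 ?_ hv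
  rintro _ ⟨α, n, rfl⟩
  rw [mul_smul, ← evalWVec_X_sub_C]
  exact Ind.smul_mem N _ hN

/-- Every proper submodule of `W(φ)` is contained in some `J_ξ`. -/
theorem exists_le_JSubmodule (hx' : LinearIndependent ℂ x)
    (hdis : Disjoint (Submodule.span ℂ (Set.range x)) (whittakerAnnihilator φ).toSubmodule)
    {N : LieSubmodule ℂ L (W φ)} (hN : N ≠ ⊤) : ∃ ξ, N ≤ JSubmodule hx hc hy ξ := by
  let M : Ideal ℂ[X] :=
    { carrier := {f | evalWVec φ y f ∈ N}
      add_mem' := fun {f g} hf hg => by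
        change evalWVec φ y (f + g) ∈ N
        rw [map_add]
        exact add_mem hf hg
      zero_mem' := by
        change evalWVec φ y 0 ∈ N
        rw [map_zero]
        exact zero_mem _
      smul_mem' := fun f g hg => by
        change evalWVec φ y (f * g) ∈ N
        rw [evalWVec_mul]
        exact Ind.smul_mem N _ hg }
  have hM : M ≠ ⊤ := by
    rw [Ne, Ideal.eq_top_iff_one]
    intro h
    change evalWVec φ y 1 ∈ N at h
    rw [evalWVec_apply, map_one, one_smul] at h
    exact hN (eq_top_of_wVec_mem h)
  obtain ⟨g, hg⟩ := (IsPrincipalIdealRing.principal M).principal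
  -- The generator is not a unit, so its degree is not `0`. The case `g = 0`, of degree `⊥`, is
  -- included: then every `ξ` is a root.
  obtain ⟨ξ, hξ⟩ := IsAlgClosed.exists_root g fun hdeg => hM (by
    rw [hg]
    exact Ideal.span_singleton_eq_top.2 (Polynomial.isUnit_iff_degree_eq_zero.2 hdeg))
  refine ⟨ξ, fun v hv => ?_⟩
  have hspan : v ∈ Submodule.span ℂ
      {v | ∃ s : I →₀ ℕ, ∃ e ∈ LinearMap.range (evalWVec φ y), v = orderedMonomial x s • e} := by
    obtain ⟨u, rfl⟩ := Ind.exists_smul_gen v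
    have := smul_mem_span_range hx hc (m := lastMonomial x y (wVec φ))
      (by rw [lastMonomial_zero]; exact wVec_mem_whittakerFiltration)
      (lastMonomial_single_add y _) u
    rw [lastMonomial_zero] at this
    refine Submodule.span_mono ?_ this
    rintro _ ⟨s, rfl⟩
    exact ⟨_, _, ⟨X ^ s ⊤, by rw [evalWVec_apply, map_pow, aeval_X]⟩, rfl⟩
  refine (Submodule.span_le (p := (JSubmodule hx hc hy ξ).toSubmodule)).2 ?_
    (mem_span_inter hx' hdis N _ (range_evalWVec_le hy) hv hspan)
  rintro _ ⟨s, _, ⟨f, rfl⟩, hf, rfl⟩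
  have hfM : f ∈ M := hf
  rw [hg] at hfM
  obtain ⟨k, hk⟩ := (dvd_iff_isRoot.2 hξ).trans (Ideal.mem_span_singleton.1 hfM)
  rw [hk, mul_comm, evalWVec_mul]
  exact Ind.smul_mem _ _ (Ind.smul_mem _ _ (evalWVec_mem_JSubmodule hx hc hy ξ))

/-- The canonical map from `W(φ)` to the module induced from an extension of `φ`. -/
theorem exists_W_to_V {φ' : LieAlgebra.LieCharacter ℂ (whittakerAnnihilator φ)}
    (h : IsExtension φ φ') :
    ∃ g : W φ →ₗ[UniversalEnvelopingAlgebra ℂ L] V φ φ',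
      g (wVec φ) = Ind.gen (whittakerAnnihilator φ).incl φ' := by
  refine Ind.exists_linearMap (f := LieIdeal.incl p) (χ := φ) _ fun q => ?_
  rw [← h q]
  exact Ind.ι_smul_gen (f := (whittakerAnnihilator φ).incl) (χ := φ')
    ⟨q, mem_whittakerAnnihilator_of_mem φ q.2⟩

theorem gen_V_ne_zero (hx' : LinearIndependent ℂ x)
    (hc' : IsCompl (Submodule.span ℂ (Set.range x)) (whittakerAnnihilator φ).toSubmodule)
    (φ' : LieAlgebra.LieCharacter ℂ (whittakerAnnihilator φ)) :
    Ind.gen (whittakerAnnihilator φ).incl φ' ≠ 0 := by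
  have hrange : LinearMap.range ((whittakerAnnihilator φ).incl :
      whittakerAnnihilator φ →ₗ[ℂ] L) = (whittakerAnnihilator φ).toSubmodule :=
    Submodule.range_subtype _
  exact Ind.gen_ne_zero_of_isCompl Subtype.val_injective hx' (hrange ▸ hc')

/-- A `U(L)`-linear map between induced modules, as a homomorphism of Lie modules. -/
def lieModuleHom {φ' : LieAlgebra.LieCharacter ℂ (whittakerAnnihilator φ)}
    (g : W φ →ₗ[UniversalEnvelopingAlgebra ℂ L] V φ φ') : W φ →ₗ⁅ℂ,L⁆ V φ φ' :=
  { g.restrictScalars ℂ with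
    map_lie' := fun {a v} => g.map_smul (UniversalEnvelopingAlgebra.ι ℂ a) v }

theorem JSubmodule_le_ker {φ' : LieAlgebra.LieCharacter ℂ (whittakerAnnihilator φ)}
    {g : W φ →ₗ[UniversalEnvelopingAlgebra ℂ L] V φ φ'}
    (hg : g (wVec φ) = Ind.gen (whittakerAnnihilator φ).incl φ') :
    JSubmodule hx hc hy (φ' ⟨y, hy⟩) ≤ (lieModuleHom g).ker := by
  refine JSubmodule_le hx hc hy ?_
  rw [LieModuleHom.mem_ker]
  change g _ = 0
  rw [evalWVec_X_sub_C, map_smul, hg, sub_smul, algebraMap_smul, sub_eq_zero]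
  exact Ind.ι_smul_gen (f := (whittakerAnnihilator φ).incl) (χ := φ') ⟨y, hy⟩

theorem ker_ne_top {φ' : LieAlgebra.LieCharacter ℂ (whittakerAnnihilator φ)}
    (hx' : LinearIndependent ℂ x)
    (hc' : IsCompl (Submodule.span ℂ (Set.range x)) (whittakerAnnihilator φ).toSubmodule)
    {g : W φ →ₗ[UniversalEnvelopingAlgebra ℂ L] V φ φ'}
    (hg : g (wVec φ) = Ind.gen (whittakerAnnihilator φ).incl φ') :
    (lieModuleHom g).ker ≠ ⊤ := by
  intro h
  have : wVec φ ∈ (lieModuleHom g).ker := h ▸ LieSubmodule.mem_top _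
  rw [LieModuleHom.mem_ker] at this
  exact gen_V_ne_zero hx' hc' φ' (hg.symm.trans this)

/-- For an extension `φ'` with `φ'(y) = ξ`, the vector `(y - ξ) w_φ` dies in the nonzero module `V φ
φ'`, while `w_φ` does not. -/
theorem JSubmodule_ne_top (hx' : LinearIndependent ℂ x)
    (hc' : IsCompl (Submodule.span ℂ (Set.range x)) (whittakerAnnihilator φ).toSubmodule)
    (hyG : Submodule.span ℂ {y} ⊔ p.toSubmodule = (whittakerAnnihilator φ).toSubmodule) (ξ : ℂ) :
    JSubmodule hx hc hy ξ ≠ ⊤ := by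
  obtain ⟨φ', hφ', rfl⟩ := exists_isExtension hx hc hy hyG ξ
  obtain ⟨g, hg⟩ := exists_W_to_V hφ'
  exact ne_top_of_le_ne_top (ker_ne_top hx' hc' hg) (JSubmodule_le_ker hx hc hy hg)

/-- Otherwise the larger submodule contains `(y - ξ) w_φ - (y - η) w_φ`, a nonzero multiple of the
cyclic vector. -/
theorem eq_of_JSubmodule_le (hx' : LinearIndependent ℂ x)
    (hc' : IsCompl (Submodule.span ℂ (Set.range x)) (whittakerAnnihilator φ).toSubmodule)
    (hyG : Submodule.span ℂ {y} ⊔ p.toSubmodule = (whittakerAnnihilator φ).toSubmodule) {ξ η : ℂ}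
    (h : JSubmodule hx hc hy ξ ≤ JSubmodule hx hc hy η) : ξ = η := by
  by_contra hne
  refine JSubmodule_ne_top hx hc hy hx' hc' hyG η (eq_top_of_wVec_mem ?_)
  have h₁ := sub_mem (h (evalWVec_mem_JSubmodule hx hc hy ξ)) (evalWVec_mem_JSubmodule hx hc hy η)
  have h₂ : evalWVec φ y (X - C ξ) - evalWVec φ y (X - C η) = (η - ξ) • wVec φ := by
    rw [← map_sub, sub_sub_sub_cancel_left, ← C_sub, evalWVec_apply, aeval_C, algebraMap_smul]
  rw [h₂] at h₁
  have h₃ := (JSubmodule hx hc hy η).smul_mem (η - ξ)⁻¹ h₁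
  rwa [smul_smul, inv_mul_cancel₀ (sub_ne_zero.2 (Ne.symm hne)), one_smul] at h₃

theorem isCoatom_iff (hx' : LinearIndependent ℂ x)
    (hc' : IsCompl (Submodule.span ℂ (Set.range x)) (whittakerAnnihilator φ).toSubmodule)
    (hyG : Submodule.span ℂ {y} ⊔ p.toSubmodule = (whittakerAnnihilator φ).toSubmodule)
    (N : LieSubmodule ℂ L (W φ)) : IsCoatom N ↔ ∃ ξ, N = JSubmodule hx hc hy ξ := by
  constructor
  · intro hN
    obtain ⟨ξ, hξ⟩ := exists_le_JSubmodule hx hc hy hx' hc'.disjoint hN.1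
    exact ⟨ξ, ((hN.le_iff_eq (JSubmodule_ne_top hx hc hy hx' hc' hyG ξ)).1 hξ).symm⟩
  · rintro ⟨ξ, rfl⟩
    refine ⟨JSubmodule_ne_top hx hc hy hx' hc' hyG ξ, fun N hN => ?_⟩
    by_contra hne
    obtain ⟨η, hη⟩ := exists_le_JSubmodule hx hc hy hx' hc'.disjoint hne
    obtain rfl := eq_of_JSubmodule_le hx hc hy hx' hc' hyG (hN.le.trans hη)
    exact hN.not_ge hη

/-- The canonical map `W φ → V φ φ'` is surjective, and its kernel is proper and contains a maximal
submodule, hence equals it. -/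
theorem nonempty_V_equiv_quotient (hx' : LinearIndependent ℂ x)
    (hc' : IsCompl (Submodule.span ℂ (Set.range x)) (whittakerAnnihilator φ).toSubmodule)
    (hyG : Submodule.span ℂ {y} ⊔ p.toSubmodule = (whittakerAnnihilator φ).toSubmodule)
    (φ' : LieAlgebra.LieCharacter ℂ (whittakerAnnihilator φ)) (hφ' : IsExtension φ φ') :
    Nonempty (V φ φ' ≃ₗ⁅ℂ,L⁆ (W φ ⧸ JSubmodule hx hc hy (φ' ⟨y, hy⟩))) := by
  obtain ⟨g, hg⟩ := exists_W_to_V hφ'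
  have hker : (lieModuleHom g).ker = JSubmodule hx hc hy (φ' ⟨y, hy⟩) :=
    (((isCoatom_iff hx hc hy hx' hc' hyG _).2 ⟨_, rfl⟩).le_iff_eq
      (ker_ne_top hx' hc' hg)).1 (JSubmodule_le_ker hx hc hy hg)
  have hsurj : Function.Surjective (g.restrictScalars ℂ) := by
    intro v
    obtain ⟨u, rfl⟩ := Ind.exists_smul_gen v
    exact ⟨u • wVec φ, by rw [LinearMap.restrictScalars_apply, map_smul, hg]⟩
  let E : (W φ ⧸ JSubmodule hx hc hy (φ' ⟨y, hy⟩)) ≃ₗ[ℂ] V φ φ' :=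
    (Submodule.quotEquivOfEq _ _ (congrArg LieSubmodule.toSubmodule hker.symm)).trans
      ((g.restrictScalars ℂ).quotKerEquivOfSurjective hsurj)
  have hE : ∀ w : W φ, E (LieSubmodule.Quotient.mk w) = g w := fun w => rfl
  let E' : (W φ ⧸ JSubmodule hx hc hy (φ' ⟨y, hy⟩)) ≃ₗ⁅ℂ,L⁆ V φ φ' :=
    { E with
      map_lie' := fun {a v} => by
        obtain ⟨w, rfl⟩ := Submodule.Quotient.mk_surjective _ v
        exact (hE ⁅a, w⁆).trans (g.map_smul (UniversalEnvelopingAlgebra.ι ℂ a) w) }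
  exact ⟨E'.symm⟩

end

end MaximalSubmodules

/-! ### The dimension of the quotient and the final assembly. -/

section Rank

variable {L : Type*} [LieRing L] [LieAlgebra ℂ L] {p : LieIdeal ℂ L}
  {φ : LieAlgebra.LieCharacter ℂ p}

theorem rank_annihilatorQuotient_eq_zero_iff :
    Module.rank ℂ (AnnihilatorQuotient φ) = 0 ↔
      (whittakerAnnihilator φ).toSubmodule ≤ p.toSubmodule := by
  rw [rank_zero_iff, Submodule.Quotient.subsingleton_iff]
  exact Submodule.comap_subtype_eq_top

end Rank

end

end QuasiWhittaker

theorem corollary3p12 {L : Type*} [LieRing L] [LieAlgebra ℂ L] (p : LieIdeal ℂ L)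
    (φ : LieAlgebra.LieCharacter ℂ p)
    (hdim : Module.rank ℂ (QuasiWhittaker.AnnihilatorQuotient φ) ≤ 1) :
    (Module.rank ℂ (QuasiWhittaker.AnnihilatorQuotient φ) = 0 →
      LieModule.IsIrreducible ℂ L (QuasiWhittaker.W φ)) ∧
    (Module.rank ℂ (QuasiWhittaker.AnnihilatorQuotient φ) = 1 →
      ∀ y : QuasiWhittaker.whittakerAnnihilator φ,
        Disjoint (Submodule.span ℂ {(y : L)}) p.toSubmodule →
        Submodule.span ℂ {(y : L)} ⊔ p.toSubmodule =
          (QuasiWhittaker.whittakerAnnihilator φ).toSubmodule →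
        ∀ (I : Type*) [LinearOrder I] (x : I → L), LinearIndependent ℂ x →
          IsCompl (Submodule.span ℂ (Set.range x))
            (QuasiWhittaker.whittakerAnnihilator φ).toSubmodule →
          ∃ N : ℂ → LieSubmodule ℂ L (QuasiWhittaker.W φ),
            (∀ ξ, (N ξ).toSubmodule = QuasiWhittaker.J φ x y ξ) ∧
            (∀ M : LieSubmodule ℂ L (QuasiWhittaker.W φ), IsCoatom M ↔ ∃ ξ, M = N ξ) ∧
            (∀ φ' : LieAlgebra.LieCharacter ℂ (QuasiWhittaker.whittakerAnnihilator φ),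
              QuasiWhittaker.IsExtension φ φ' →
              Nonempty (QuasiWhittaker.V φ φ' ≃ₗ⁅ℂ,L⁆ (QuasiWhittaker.W φ ⧸ N (φ' y))))) := by
  refine ⟨fun h => QuasiWhittaker.isIrreducible_W
    (QuasiWhittaker.rank_annihilatorQuotient_eq_zero_iff.1 h), ?_⟩
  rintro hrank ⟨y, hy⟩ hdis hyG I _ x hx' hc'
  -- Disjointness alone would allow `y = 0`; rank one excludes it, since `y ∈ p` would make the
  -- annihilator equal to `p`.
  have hyp : y ∉ p := by
    intro h
    have h₁ : Submodule.span ℂ {y} ≤ p.toSubmodule :=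
      (Submodule.span_singleton_le_iff_mem _ _).2 h
    have h₂ := QuasiWhittaker.rank_annihilatorQuotient_eq_zero_iff.2
      (hyG.symm.trans (sup_eq_right.2 h₁)).le
    rw [hrank] at h₂
    exact one_ne_zero h₂
  obtain ⟨hx, hc⟩ := QuasiWhittaker.withLast_basis hx' hyp hyG hdis hc'
  exact ⟨QuasiWhittaker.JSubmodule hx hc hy, fun ξ => rfl,
    QuasiWhittaker.isCoatom_iff hx hc hy hx' hc' hyG,
    QuasiWhittaker.nonempty_V_equiv_quotient hx hc hy hx' hc' hyG⟩
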